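/- For a set $\mathfrak F\subset\mathbb R$ and a continuous function $f$ on $\mathfrak F$, let $\|f\|_{\mathrm{OL}(\mathfrak F)}\in[0,\infty]$ denote the smallest constant $C$ such that $\|f(A)-f(B)\|\le C\|A-B\|$ for all (bounded or unbounded) self-adjoint operators $A$, $B$ on a complex Hilbert space whose spectra are contained in $\mathfrak F$; put $\|f\|_{\mathrm{OL}(\mathfrak F)}=\infty$ if there is no such $C$. (Here $\|A-B\|=\infty$ unless $A$ and $B$ have the same domain and $A-B$ is bounded on it.) Put $\mathrm{Abs}(x)=|x|$. For an interval $J\subset(0,\infty)$, let $|\log(J)|\in[0,\infty]$ denote the length of the interval $\log(J)=\{\log t: t\in J\}$, with $|\log(\varnothing)|=0$, and let $\log\infty=\infty$. There exist positive numbers $C_1$ and $C_2$ such that $$ C_1\log\big(2+|\log(J_1\cap J_2)|\big)\le\|\mathrm{Abs}\|_{\mathrm{OL}((-J_1)\cup J_2)}\le C_2\log\big(2+|\log(J_1\cap J_2)|\big) $$ for all intervals $J_1$ and $J_2$ in $(0,\infty)$ (open, closed or half-open, bounded or not) at least one of which has more than one point. -/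

import Mathlib

open MeasureTheory Set
open scoped ENNReal NNReal Pointwise

universe u

section OperatorLipschitz

variable {H : Type u} [NormedAddCommGroup H] [InnerProductSpace ℂ H] [CompleteSpace H]

/-- A spectral measure (projection-valued measure, resolution of the identity) on the Borel
subsets of `ℝ`, acting on the Hilbert space `H`. Countable additivity is in the strong operator
topology. The values on non-measurable sets play no role. -/
structure SpectralMeasure (H : Type u) [NormedAddCommGroup H] [InnerProductSpace ℂ H]
    [CompleteSpace H] where
  /-- The projection attached to a Borel set. -/
  proj : Set ℝ → H →L[ℂ] H
  isStarProjection : ∀ s, MeasurableSet s → IsStarProjection (proj s)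
  proj_univ : proj univ = 1
  hasSum_proj : ∀ s : ℕ → Set ℝ, (∀ n, MeasurableSet (s n)) → Pairwise (Function.onFun Disjoint s) →
    ∀ v : H, HasSum (fun n => proj (s n) v) (proj (⋃ n, s n) v)

namespace SpectralMeasure

theorem proj_empty (E : SpectralMeasure H) : E.proj ∅ = 0 := by
  ext v
  have h := E.hasSum_proj (fun _ => ∅) (fun _ => MeasurableSet.empty)
    (fun _ _ _ => disjoint_bot_left) v
  simpa using (summable_const_iff (G := H) (β := ℕ) _).1 h.summable

theorem re_inner_proj (E : SpectralMeasure H) {s : Set ℝ} (hs : MeasurableSet s) (v : H) :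
    (inner ℂ v (E.proj s v)).re = ‖E.proj s v‖ ^ 2 := by
  have hp := E.isStarProjection s hs
  have h1 : E.proj s (E.proj s v) = E.proj s v :=
    congrArg (fun T : H →L[ℂ] H => T v) hp.isIdempotentElem.eq
  have h2 : inner ℂ (E.proj s v) (E.proj s v) = inner ℂ v (E.proj s v) := by
    rw [← ContinuousLinearMap.adjoint_inner_right, ← ContinuousLinearMap.star_eq_adjoint,
      hp.isSelfAdjoint.star_eq, h1]
  rw [← h2]
  simpa using inner_self_eq_norm_sq (𝕜 := ℂ) (E.proj s v)

/-- The scalar measure `s ↦ ⟪v, E(s) v⟫ = ‖E(s) v‖ ^ 2`. -/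
noncomputable def scalarMeasure (E : SpectralMeasure H) (v : H) : Measure ℝ :=
  Measure.ofMeasurable (fun s _ => ENNReal.ofReal (‖E.proj s v‖ ^ 2))
    (by simp [E.proj_empty])
    (by
      intro s hs hd
      have h := (E.hasSum_proj s hs hd v).mapL
        (Complex.reCLM.comp ((innerSL ℂ v).restrictScalars ℝ))
      have h' : HasSum (fun n => ‖E.proj (s n) v‖ ^ 2) (‖E.proj (⋃ n, s n) v‖ ^ 2) := by
        rw [← E.re_inner_proj (MeasurableSet.iUnion hs)]
        simp_rw [← fun n => E.re_inner_proj (hs n) v]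
        exact h
      rw [← h'.tsum_eq, ENNReal.ofReal_tsum_of_nonneg (fun _ => by positivity) h'.summable])

/-- `E.IsIntegral f T` says that `T = ∫ f dE`: the domain of the (possibly unbounded) operator `T`
is `{v : ∫ |f|² d⟪v, E v⟫ < ∞}`, and `⟪v, T v⟫ = ∫ f d⟪v, E v⟫` on this domain. By polarization
this determines `T`. -/
def IsIntegral (E : SpectralMeasure H) (f : ℝ → ℂ) (T : H →ₗ.[ℂ] H) : Prop :=
  (∀ v : H, v ∈ T.domain ↔ MemLp f 2 (E.scalarMeasure v)) ∧
  ∀ v : T.domain, inner ℂ (v : H) (T v) = ∫ x, f x ∂(E.scalarMeasure v)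

end SpectralMeasure

/-- The functional calculus of a self-adjoint operator `A`, bounded or not: `T = f(A)`, that is,
`A = ∫ x dE(x)` and `T = ∫ f(x) dE(x)` for a spectral measure `E` (the one of `A`, which exists and
is unique by the spectral theorem). -/
def IsFunctionOf (f : ℝ → ℂ) (A T : H →ₗ.[ℂ] H) : Prop :=
  ∃ E : SpectralMeasure H, E.IsIntegral (fun x => (x : ℂ)) A ∧ E.IsIntegral f T

/-- The real spectrum of a possibly unbounded operator `A`: the real numbers `r` for which
`A - r` does not have a bounded everywhere defined inverse `R`. (The spectrum of a self-adjoint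
operator is real.) -/
def unboundedSpectrum (A : H →ₗ.[ℂ] H) : Set ℝ :=
  {r : ℝ | ¬ ∃ R : H →L[ℂ] H, (∀ v : A.domain, R (A v - (r : ℂ) • (v : H)) = v) ∧
    ∀ w : H, ∃ h : R w ∈ A.domain, A ⟨R w, h⟩ - (r : ℂ) • R w = w}

/-- `‖S - T‖ ≤ c` for possibly unbounded operators: they have the same domain, on which `S - T` is
bounded with norm at most `c`. If this fails for all `c`, then `‖S - T‖ = ∞`. -/
def NormSubLE (S T : H →ₗ.[ℂ] H) (c : ℝ≥0) : Prop :=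
  S.domain = T.domain ∧
  ∀ (v : H) (hS : v ∈ S.domain) (hT : v ∈ T.domain), ‖S ⟨v, hS⟩ - T ⟨v, hT⟩‖ ≤ c * ‖v‖

end OperatorLipschitz

/-- `f` is operator Lipschitz on `F` with constant `C`: `‖f(A) - f(B)‖ ≤ C ‖A - B‖` for all
self-adjoint operators `A`, `B` (bounded or not, on any complex Hilbert space) with spectra
in `F`. -/
def IsOperatorLipschitzWith (f : ℝ → ℂ) (F : Set ℝ) (C : ℝ≥0) : Prop :=
  ∀ (H : Type u) [NormedAddCommGroup H] [InnerProductSpace ℂ H] [CompleteSpace H]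
    (A B fA fB : H →ₗ.[ℂ] H), IsSelfAdjoint A → IsSelfAdjoint B →
    unboundedSpectrum A ⊆ F → unboundedSpectrum B ⊆ F →
    IsFunctionOf f A fA → IsFunctionOf f B fB →
    ∀ δ : ℝ≥0, NormSubLE A B δ → NormSubLE fA fB (C * δ)

/-- The operator Lipschitz norm of `f` (continuous on `F`): the smallest constant `C` with
`‖f(A) - f(B)‖ ≤ C ‖A - B‖`, and `∞` if there is none. -/
noncomputable def operatorLipschitzNorm (f : ℝ → ℂ) (F : Set ℝ) : ℝ≥0∞ :=
  ⨅ (C : ℝ≥0) (_ : IsOperatorLipschitzWith.{u} f F C), (C : ℝ≥0∞)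

/-- The length `|log J| ∈ [0, ∞]` of the interval `log J = {log t : t ∈ J}`, for an interval `J`
in `(0, ∞)`. -/
noncomputable def logLength (J : Set ℝ) : ℝ≥0∞ := volume (Real.log '' J)

/-- `log (2 + ℓ) ∈ (0, ∞]` for `ℓ ∈ [0, ∞]`, with `log ∞ = ∞`. -/
noncomputable def logTwoAdd (l : ℝ≥0∞) : ℝ≥0∞ := (ENNReal.log (2 + l)).toENNReal

/-! Upper bound. Split both operators by their spectral projections on `-J₁` and `J₂`. On the two
diagonal blocks `|x|` is the same multiple `±x` on both sides, so `|A| - |B|` is `±(A - B)` and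
costs `δ`. On an off-diagonal block the signs differ: with `T₁ = |A|`, `T₂ = |B|` and `X` the
product of the two projections, the hypothesis bounds the sum `T₁ X + X T₂` by `δ`, and the
difference `T₁ X - X T₂` has to be bounded. The basic tool is the Sylvester estimate
`norm_inner_le`: if `T₁ ≥ p` and `T₂ ≥ q`, then `‖X‖ ≤ δ / (p + q)`. It gives `3δ` when a number `c`
separates the two spectra, and `κδ` when both lie in `[p, κp]`. Halving an interval on the
logarithmic scale leaves two diagonal blocks, which share one bound, and two separated off-diagonal
blocks; each doubling of the logarithmic length thus adds only `3δ` (`diff_dyadic`), whence a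
logarithm of `|log(J₁ ∩ J₂)|`. Outside `J₁ ∩ J₂` the spectra are separated anyway
(`diff_of_intervals`).

Lower bound. Conjugating a diagonal matrix `D` by `exp(tK)` and differentiating at `0` turns an
operator Lipschitz bound into the commutator bound `‖[K, f(D)]‖ ≤ C ‖[K, D]‖`. Let `D` have
eigenvalues `±t j`, where `t` at least doubles at each step, and let `K` have entries `1 / ((j -
k)(t j + t k))` between eigenvectors of opposite sign. Then `[K, D]` consists of two Hilbert
matrices `±1 / (j - k)`, of norm at most `π`, while in `[K, |D|]` the entries are multiplied by `±(t
j - t k) / (t j + t k)`. This factor cancels the oscillation of the Hilbert matrix and leaves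
entries of one sign and size at least `1 / (3 |j - k|)` off the diagonal of a block; the norm is
therefore of order `log n`. An interval `J₁ ∩ J₂` of logarithmic length `L` has room for about `L`
such points. The trivial bound `C ≥ 1`, from two points of the same sign, covers short
intersections. -/

open Filter Topology

/-! ### Spectral measures and their integrals -/

section Spectral

variable {H : Type u} [NormedAddCommGroup H] [InnerProductSpace ℂ H]

/-- Two sesquilinear forms with the same quadratic form coincide. -/
theorem inner_eq_of_inner_self_eq {D : Type*} [AddCommGroup D] [Module ℂ D]
    (j T k S : D →ₗ[ℂ] H) (h : ∀ v, inner ℂ (j v) (T v) = inner ℂ (k v) (S v)) (u v : D) :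
    inner ℂ (j u) (T v) = inner ℂ (k u) (S v) := by
  have h1 := h (u + v)
  have h2 := h (u + Complex.I • v)
  simp only [map_add, map_smul, inner_add_left, inner_add_right, inner_smul_left,
    inner_smul_right, h u, h v, Complex.conj_I] at h1 h2
  have hI : Complex.I * Complex.I = -1 := Complex.I_mul_I
  linear_combination (1 / 2 : ℂ) * h1 - (Complex.I / 2) * h2 +
    (inner ℂ (j u) (T v) / 2 - inner ℂ (k u) (S v) / 2 - inner ℂ (j v) (T u) / 2
      + inner ℂ (k v) (S u) / 2) * hI

variable [CompleteSpace H]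

namespace SpectralMeasure

variable (E : SpectralMeasure H) {S T : Set ℝ}

theorem proj_union (hS : MeasurableSet S) (hT : MeasurableSet T) (hd : Disjoint S T) (v : H) :
    E.proj (S ∪ T) v = E.proj S v + E.proj T v := by
  let s : ℕ → Set ℝ := fun n => if n = 0 then S else if n = 1 then T else ∅
  have hs : ∀ n, MeasurableSet (s n) := by
    intro n
    dsimp only [s]
    split_ifs
    exacts [hS, hT, MeasurableSet.empty]
  have hdis : Pairwise (Function.onFun Disjoint s) := by
    intro m n hmn
    simp only [Function.onFun, s]
    split_ifs
    all_goals first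
      | (exfalso; omega)
      | exact hd
      | exact hd.symm
      | simp
  have hU : (⋃ n, s n) = S ∪ T := by
    ext x
    simp only [mem_iUnion, mem_union, s]
    constructor
    · rintro ⟨n, hn⟩
      split_ifs at hn
      exacts [Or.inl hn, Or.inr hn, absurd hn (by simp)]
    · rintro (h | h)
      exacts [⟨0, by simpa using h⟩, ⟨1, by simpa using h⟩]
  have h1 := E.hasSum_proj s hs hdis v
  have h2 : HasSum (fun n => E.proj (s n) v) (∑ n ∈ Finset.range 2, E.proj (s n) v) := by
    apply hasSum_sum_of_ne_finset_zero
    intro n hn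
    have : 1 < n := by simpa using hn
    have h0 : s n = ∅ := by
      dsimp only [s]
      rw [if_neg (by omega), if_neg (by omega)]
    rw [h0, E.proj_empty]
    rfl
  rw [← hU, h1.unique h2]
  simp [Finset.sum_range_succ, s]

theorem proj_proj_self (hS : MeasurableSet S) (v : H) : E.proj S (E.proj S v) = E.proj S v :=
  congrArg (fun T : H →L[ℂ] H => T v) (E.isStarProjection S hS).isIdempotentElem.eq

theorem inner_proj_left (hS : MeasurableSet S) (u v : H) :
    inner ℂ (E.proj S u) v = inner ℂ u (E.proj S v) := by
  rw [← ContinuousLinearMap.adjoint_inner_right, ← ContinuousLinearMap.star_eq_adjoint,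
    (E.isStarProjection S hS).isSelfAdjoint.star_eq]

theorem norm_proj_le (hS : MeasurableSet S) (v : H) : ‖E.proj S v‖ ≤ ‖v‖ := by
  have h := E.re_inner_proj hS v
  have h2 : (inner ℂ v (E.proj S v)).re ≤ ‖v‖ * ‖E.proj S v‖ :=
    (Complex.re_le_norm _).trans (norm_inner_le_norm _ _)
  by_contra! hlt
  nlinarith [norm_nonneg v]

/-- Multiplicativity is not part of the definition; it follows from additivity. For `w = E(S) v` one
gets `‖w‖² + ‖E(T) w‖² = ‖E(S ∪ T) w‖² ≤ ‖w‖²`. -/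
theorem proj_proj_of_disjoint (hS : MeasurableSet S) (hT : MeasurableSet T) (hd : Disjoint S T)
    (v : H) : E.proj T (E.proj S v) = 0 := by
  set w := E.proj S v with hw
  have h0 : E.proj S w = w := E.proj_proj_self hS v
  have h1 := E.re_inner_proj (hS.union hT) w
  have h2 := E.re_inner_proj hS w
  have h3 := E.re_inner_proj hT w
  have h4 := E.norm_proj_le (hS.union hT) w
  rw [proj_union E hS hT hd, inner_add_right, Complex.add_re, h2, h3, h0] at h1
  rw [proj_union E hS hT hd, h0] at h4
  have h5 : ‖w + E.proj T w‖ ^ 2 ≤ ‖w‖ ^ 2 := by gcongr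
  have : ‖E.proj T w‖ ^ 2 ≤ 0 := by linarith
  simpa using this

theorem proj_proj (hS : MeasurableSet S) (hT : MeasurableSet T) (v : H) :
    E.proj T (E.proj S v) = E.proj (S ∩ T) v := by
  have h1 : E.proj S v = E.proj (S ∩ T) v + E.proj (S \ T) v := by
    conv_lhs => rw [← inter_union_sdiff S T]
    exact E.proj_union (hS.inter hT) (hS.diff hT) (disjoint_sdiff_inter.symm) v
  have h2 : E.proj T (E.proj (S ∩ T) v) = E.proj (S ∩ T) v := by
    set w := E.proj (S ∩ T) v with hw
    have h3 : E.proj T w = E.proj (T ∩ S) w + E.proj (T \ S) w := by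
      conv_lhs => rw [← inter_union_sdiff T S]
      exact E.proj_union (hT.inter hS) (hT.diff hS) (disjoint_sdiff_inter.symm) w
    rw [h3, inter_comm T S, hw, E.proj_proj_self (hS.inter hT),
      E.proj_proj_of_disjoint (hS.inter hT) (hT.diff hS)
        (disjoint_sdiff_right.mono_left inter_subset_left), add_zero]
  rw [h1, map_add, h2, E.proj_proj_of_disjoint (hS.diff hT) hT disjoint_sdiff_left, add_zero]

theorem proj_eq_self_mono (hS : MeasurableSet S) (hT : MeasurableSet T) (h : S ⊆ T) {v : H}
    (hv : E.proj S v = v) : E.proj T v = v := by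
  rw [← hv, E.proj_proj hS hT, inter_eq_self_of_subset_left h]

theorem proj_add_compl (hS : MeasurableSet S) (v : H) : E.proj S v + E.proj Sᶜ v = v := by
  rw [← E.proj_union hS hS.compl disjoint_compl_right, union_compl_self, E.proj_univ]
  rfl

theorem proj_compl_eq_zero (hS : MeasurableSet S) {v : H} (hv : E.proj S v = v) :
    E.proj Sᶜ v = 0 := by
  simpa [hv] using E.proj_add_compl hS v

theorem scalarMeasure_apply (hS : MeasurableSet S) (v : H) :
    E.scalarMeasure v S = ENNReal.ofReal (‖E.proj S v‖ ^ 2) :=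
  Measure.ofMeasurable_apply S hS

theorem scalarMeasure_univ (v : H) : E.scalarMeasure v univ = ENNReal.ofReal (‖v‖ ^ 2) := by
  rw [E.scalarMeasure_apply MeasurableSet.univ, E.proj_univ]
  rfl

instance (v : H) : IsFiniteMeasure (E.scalarMeasure v) :=
  ⟨by rw [E.scalarMeasure_univ]; exact ENNReal.ofReal_lt_top⟩

theorem scalarMeasure_proj (hS : MeasurableSet S) (v : H) :
    E.scalarMeasure (E.proj S v) = (E.scalarMeasure v).restrict S := by
  ext s hs
  rw [Measure.restrict_apply hs, E.scalarMeasure_apply hs, E.scalarMeasure_apply (hs.inter hS),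
    E.proj_proj hS hs, inter_comm]

theorem scalarMeasure_smul {c : ℂ} (hc : ‖c‖ = 1) (v : H) :
    E.scalarMeasure (c • v) = E.scalarMeasure v := by
  ext s hs
  rw [E.scalarMeasure_apply hs, E.scalarMeasure_apply hs, map_smul, norm_smul, hc, one_mul]

theorem scalarMeasure_add (hS : MeasurableSet S) {v w : H} (hv : E.proj S v = v)
    (hw : E.proj Sᶜ w = w) :
    E.scalarMeasure (v + w) = E.scalarMeasure v + E.scalarMeasure w := by
  ext s hs
  rw [Measure.add_apply, E.scalarMeasure_apply hs, E.scalarMeasure_apply hs,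
    E.scalarMeasure_apply hs, ← ENNReal.ofReal_add (by positivity) (by positivity), map_add]
  congr 1
  have h1 : E.proj s v = E.proj S (E.proj s v) := by
    rw [E.proj_proj hs hS, inter_comm, ← E.proj_proj hS hs, hv]
  have h2 : E.proj S (E.proj s w) = 0 := by
    rw [E.proj_proj hs hS, inter_comm, ← E.proj_proj hS hs]
    have : E.proj S w = 0 := by
      rw [← hw]
      exact E.proj_proj_of_disjoint hS.compl hS disjoint_compl_left w
    rw [this, map_zero]
  have h3 : inner ℂ (E.proj s v) (E.proj s w) = 0 := by
    rw [h1, E.inner_proj_left hS, h2, inner_zero_right]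
  rw [sq, sq, sq]
  exact norm_add_sq_eq_norm_sq_add_norm_sq_of_inner_eq_zero _ _ h3

theorem ae_mem_of_proj_eq_self (hS : MeasurableSet S) {v : H} (hv : E.proj S v = v) :
    ∀ᵐ x ∂(E.scalarMeasure v), x ∈ S := by
  rw [ae_iff]
  change E.scalarMeasure v Sᶜ = 0
  rw [E.scalarMeasure_apply hS.compl, E.proj_compl_eq_zero hS hv]
  simp

theorem proj_eq_self_of_ae_mem (hS : MeasurableSet S) {v : H}
    (hv : E.scalarMeasure v Sᶜ = 0) : E.proj S v = v := by
  rw [E.scalarMeasure_apply hS.compl, ENNReal.ofReal_eq_zero] at hv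
  have h : E.proj Sᶜ v = 0 := by
    have : ‖E.proj Sᶜ v‖ ^ 2 = 0 := le_antisymm hv (by positivity)
    simpa using this
  simpa [h] using E.proj_add_compl hS v

/-- Spectral projections of an increasing exhausting sequence converge strongly to `1`. -/
theorem tendsto_proj {s : ℕ → Set ℝ} (hs : ∀ n, MeasurableSet (s n)) (hm : Monotone s)
    (hU : ⋃ n, s n = univ) (v : H) : Tendsto (fun n => E.proj (s n) v) atTop (𝓝 v) := by
  have h1 : Tendsto (E.scalarMeasure v ∘ fun n => (s n)ᶜ) atTop
      (𝓝 (E.scalarMeasure v (⋂ n, (s n)ᶜ))) :=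
    tendsto_measure_iInter_atTop (fun n => (hs n).compl.nullMeasurableSet)
      (fun m n h => compl_subset_compl.2 (hm h)) ⟨0, measure_ne_top _ _⟩
  rw [← compl_iUnion, hU, compl_univ, measure_empty] at h1
  have h2 := (ENNReal.tendsto_toReal ENNReal.zero_ne_top).comp h1
  have h3 : ∀ n, (E.scalarMeasure v (s n)ᶜ).toReal = ‖E.proj (s n) v - v‖ ^ 2 := by
    intro n
    rw [E.scalarMeasure_apply (hs n).compl, ENNReal.toReal_ofReal (by positivity)]
    congr 1
    rw [norm_sub_rev]
    congr 1
    rw [eq_sub_iff_add_eq']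
    exact E.proj_add_compl (hs n) v
  have h4 : Tendsto (fun n => ‖E.proj (s n) v - v‖ ^ 2) atTop (𝓝 0) := by
    simpa [Function.comp_def, h3] using h2
  have h5 := h4.sqrt
  simp only [Real.sqrt_zero, Real.sqrt_sq (norm_nonneg _)] at h5
  exact tendsto_iff_norm_sub_tendsto_zero.2 h5

/-! ### Operators `∫ f dE`, accessible only through their quadratic forms -/

namespace IsIntegral

variable {E} {f : ℝ → ℂ} {T : H →ₗ.[ℂ] H}

theorem proj_mem_domain (hT : E.IsIntegral f T) (hS : MeasurableSet S) {v : H} (hv : v ∈ T.domain) :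
    E.proj S v ∈ T.domain := by
  rw [hT.1] at hv ⊢
  rw [E.scalarMeasure_proj hS]
  exact hv.restrict S

theorem mem_domain_of_bounded (hT : E.IsIntegral f T) (hf : Measurable f) (hS : MeasurableSet S) {v : H}
    (hv : E.proj S v = v) {r : ℝ} (hr : ∀ x ∈ S, ‖f x‖ ≤ r) : v ∈ T.domain := by
  rw [hT.1]
  refine MemLp.of_bound hf.aestronglyMeasurable r ?_
  filter_upwards [E.ae_mem_of_proj_eq_self hS hv] with x hx using hr x hx


/-- The scalar measure of `c • v + w` is the sum of those of `v` and `w` for every unimodular `c`,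
so the cross terms of the quadratic form vanish for `c = 1` and `c = I`, hence separately. -/
theorem inner_apply_of_proj (hT : E.IsIntegral f T) (hS : MeasurableSet S) (v w : T.domain)
    (hv : E.proj S v = v) (hw : E.proj Sᶜ w = w) : inner ℂ (w : H) (T v) = 0 := by
  have key : ∀ c : ℂ, ‖c‖ = 1 → inner ℂ ((c • v + w : T.domain) : H) (T (c • v + w)) =
      inner ℂ (v : H) (T v) + inner ℂ (w : H) (T w) := by
    intro c hc
    have hcv : E.proj S (c • (v : H)) = c • (v : H) := by rw [map_smul, hv]
    have hi : ∀ v : T.domain, Integrable f (E.scalarMeasure v) := fun v =>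
      ((hT.1 v).1 v.2).integrable (by norm_num)
    rw [hT.2, hT.2, hT.2, Submodule.coe_add, Submodule.coe_smul, E.scalarMeasure_add hS hcv hw,
      E.scalarMeasure_smul hc, integral_add_measure (hi v) (hi w)]
  have h1 := key 1 (by simp)
  have h2 := key Complex.I (by simp)
  simp only [Submodule.coe_add, Submodule.coe_smul, LinearPMap.map_add, LinearPMap.map_smul,
    inner_add_left, inner_add_right, inner_smul_left, inner_smul_right,
    Complex.conj_I, one_smul] at h1 h2
  have hI : Complex.I * Complex.I = -1 := Complex.I_mul_I
  linear_combination (1 / 2 : ℂ) * h1 - (Complex.I / 2) * h2 +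
    (-Complex.I * inner ℂ (v : H) (T v) / 2 + inner ℂ (w : H) (T v) / 2
      - inner ℂ (v : H) (T w) / 2) * hI

theorem dense_domain (hT : E.IsIntegral f T) (hf : Measurable f) : Dense (T.domain : Set H) := by
  intro v
  have hm : ∀ n : ℕ, MeasurableSet {x | ‖f x‖ ≤ n} := fun n =>
    measurableSet_le hf.norm measurable_const
  refine mem_closure_of_tendsto (E.tendsto_proj hm ?_ ?_ v) (Eventually.of_forall fun n =>
    hT.mem_domain_of_bounded hf (hm n) (E.proj_proj_self (hm n) v) (r := n) fun x hx => hx)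
  · intro m n hmn x hx
    exact le_trans (b := (m : ℝ)) hx (by exact_mod_cast hmn)
  · exact eq_univ_of_forall fun x => mem_iUnion.2 (exists_nat_ge ‖f x‖)

theorem proj_apply_of_proj (hT : E.IsIntegral f T) (hf : Measurable f) (hS : MeasurableSet S) (v : T.domain)
    (hv : E.proj S v = v) : E.proj S (T v) = T v := by
  have h0 : E.proj Sᶜ (T v) = 0 := by
    refine (hT.dense_domain hf).eq_zero_of_inner_left (𝕜 := ℂ) fun w hw => ?_
    rw [E.inner_proj_left hS.compl, ← inner_conj_symm,
      hT.inner_apply_of_proj hS v ⟨_, hT.proj_mem_domain hS.compl hw⟩ hv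
        (E.proj_proj_self hS.compl w), map_zero]
  simpa [h0] using E.proj_add_compl hS (T v)

theorem inner_apply_comm {g : ℝ → ℝ} (hT : E.IsIntegral (fun x => (g x : ℂ)) T)
    (u v : T.domain) : inner ℂ (u : H) (T v) = inner ℂ (T u) (v : H) := by
  refine inner_eq_of_inner_self_eq T.domain.subtype T.toFun T.toFun T.domain.subtype
    (fun v => ?_) u v
  change inner ℂ (v : H) (T v) = inner ℂ (T v) (v : H)
  rw [← inner_conj_symm (T v), hT.2]
  dsimp only
  rw [integral_complex_ofReal, Complex.conj_ofReal]

/-- If `f = σ f'` on `S` then `∫ f dE = σ ∫ f' dE` on the range of `E(S)`. -/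
theorem apply_eq_smul {f' : ℝ → ℂ} {T' : H →ₗ.[ℂ] H} (hT : E.IsIntegral f T) (hT' : E.IsIntegral f' T')
    (hf : Measurable f) (hf' : Measurable f') (hS : MeasurableSet S) (σ : ℂ)
    (h : ∀ x ∈ S, f x = σ * f' x) {v : H} (hv : E.proj S v = v) (h1 : v ∈ T.domain)
    (h2 : v ∈ T'.domain) : T ⟨v, h1⟩ = σ • T' ⟨v, h2⟩ := by
  set D : Submodule ℂ H := T.domain ⊓ T'.domain
  let R : D →ₗ[ℂ] H := T.toFun ∘ₗ Submodule.inclusion inf_le_left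
  let R' : D →ₗ[ℂ] H := T'.toFun ∘ₗ Submodule.inclusion inf_le_right
  let P : D →ₗ[ℂ] D := ((E.proj S : H →ₗ[ℂ] H) ∘ₗ D.subtype).codRestrict D fun w =>
    ⟨hT.proj_mem_domain hS w.2.1, hT'.proj_mem_domain hS w.2.2⟩
  have key := inner_eq_of_inner_self_eq (D.subtype ∘ₗ P) (R ∘ₗ P) (D.subtype ∘ₗ P)
    (σ • (R' ∘ₗ P)) (fun w => by
      change inner ℂ (E.proj S w) (T ⟨E.proj S w, hT.proj_mem_domain hS w.2.1⟩) =
        inner ℂ (E.proj S w) (σ • T' ⟨E.proj S w, hT'.proj_mem_domain hS w.2.2⟩)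
      have e1 := hT.2 ⟨E.proj S w, hT.proj_mem_domain hS w.2.1⟩
      have e2 := hT'.2 ⟨E.proj S w, hT'.proj_mem_domain hS w.2.2⟩
      dsimp only at e1 e2
      rw [inner_smul_right, e1, e2, ← integral_const_mul]
      refine integral_congr_ae ?_
      filter_upwards [E.ae_mem_of_proj_eq_self hS (E.proj_proj_self hS (w : H))] with x hx
        using h x hx)
  have hPv : ∀ (h : v ∈ D), P ⟨v, h⟩ = ⟨v, h⟩ := fun h => Subtype.ext hv
  have key2 : ∀ w ∈ (T.domain ⊓ T'.domain : Submodule ℂ H),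
      inner ℂ (E.proj S w) (T ⟨v, h1⟩ - σ • T' ⟨v, h2⟩) = 0 := by
    intro w hw
    have := key ⟨w, hw⟩ ⟨v, Submodule.mem_inf.2 ⟨h1, h2⟩⟩
    simp only [LinearMap.comp_apply, LinearMap.smul_apply] at this
    rw [hPv] at this
    rw [inner_sub_right]
    exact sub_eq_zero.2 this
  have hz : E.proj S (T ⟨v, h1⟩ - σ • T' ⟨v, h2⟩) = T ⟨v, h1⟩ - σ • T' ⟨v, h2⟩ := by
    rw [map_sub, map_smul, hT.proj_apply_of_proj hf hS ⟨v, h1⟩ hv,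
      hT'.proj_apply_of_proj hf' hS ⟨v, h2⟩ hv]
  set z := T ⟨v, h1⟩ - σ • T' ⟨v, h2⟩ with hzdef
  -- The orthogonality in `key2` is known only for vectors of the common domain; truncating both
  -- functions at once shows that this domain is dense.
  have hm : ∀ n : ℕ, MeasurableSet {x | ‖f x‖ ≤ n ∧ ‖f' x‖ ≤ n} := fun n =>
    (measurableSet_le hf.norm measurable_const).inter (measurableSet_le hf'.norm measurable_const)
  have hd : Dense (D : Set H) := by
    intro v
    refine mem_closure_of_tendsto (E.tendsto_proj hm ?_ ?_ v) (Eventually.of_forall fun n =>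
      ⟨hT.mem_domain_of_bounded hf (hm n) (E.proj_proj_self (hm n) v) (r := n) fun x hx => hx.1,
        hT'.mem_domain_of_bounded hf' (hm n) (E.proj_proj_self (hm n) v) (r := n)
          fun x hx => hx.2⟩)
    · intro m n hmn x hx
      have : (m : ℝ) ≤ n := by exact_mod_cast hmn
      exact ⟨hx.1.trans this, hx.2.trans this⟩
    · refine eq_univ_of_forall fun x => mem_iUnion.2 ?_
      obtain ⟨n, hn⟩ := exists_nat_ge (max ‖f x‖ ‖f' x‖)
      exact ⟨n, (le_max_left _ _).trans hn, (le_max_right _ _).trans hn⟩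
  have : z = 0 := by
    refine hd.eq_zero_of_inner_right (𝕜 := ℂ) fun w hw => ?_
    rw [← hz, ← E.inner_proj_left hS]
    exact key2 w hw
  exact sub_eq_zero.1 this

/-- If `|g - c| ≤ r` on `S` then `‖∫ g dE - c‖ ≤ r` on the range of `E(S)`. -/
theorem norm_apply_sub_le {g : ℝ → ℝ} (hg : Measurable g)
    (hT : E.IsIntegral (fun x => (g x : ℂ)) T) (hS : MeasurableSet S) {c r : ℝ}
    (h : ∀ x ∈ S, |g x - c| ≤ r) (v : T.domain) (hv : E.proj S v = v) :
    ‖T v - (c : ℂ) • (v : H)‖ ≤ r * ‖(v : H)‖ := by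
  have hgm : Measurable fun x => (g x : ℂ) := Complex.measurable_ofReal.comp hg
  set q : T.domain → ℝ := fun w => (inner ℂ (w : H) (T w - (c : ℂ) • (w : H))).re with hq
  have hqb : ∀ w : T.domain, E.proj S w = w → |q w| ≤ r * ‖(w : H)‖ ^ 2 := by
    intro w hw
    have hi : Integrable (fun x => (g x : ℂ)) (E.scalarMeasure w) :=
      ((hT.1 w).1 w.2).integrable (by norm_num)
    have e1 : inner ℂ (w : H) (T w - (c : ℂ) • (w : H)) =
        ∫ x, ((g x : ℂ) - c) ∂(E.scalarMeasure (w : H)) := by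
      rw [integral_sub hi (integrable_const _), inner_sub_right, hT.2, inner_smul_right,
        integral_const, inner_self_eq_norm_sq_to_K, Measure.real, E.scalarMeasure_univ,
        ENNReal.toReal_ofReal (by positivity), Complex.real_smul, mul_comm (c : ℂ)]
      simp
    have e2 : ‖inner ℂ (w : H) (T w - (c : ℂ) • (w : H))‖ ≤ r * ‖(w : H)‖ ^ 2 := by
      rw [e1]
      have := norm_integral_le_of_norm_le_const (μ := E.scalarMeasure (w : H)) (C := r)
        (f := fun x => ((g x : ℂ) - c)) (by
          filter_upwards [E.ae_mem_of_proj_eq_self hS hw] with x hx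
          rw [← Complex.ofReal_sub, Complex.norm_real]
          exact h x hx)
      rwa [Measure.real, E.scalarMeasure_univ, ENNReal.toReal_ofReal (by positivity)] at this
    exact (Complex.abs_re_le_norm _).trans e2
  obtain ⟨n, hn⟩ : ∃ n : ℝ, ∀ x ∈ S, ‖(g x : ℂ)‖ ≤ n := by
    refine ⟨|c| + r, fun x hx => ?_⟩
    rw [Complex.norm_real, Real.norm_eq_abs]
    have := abs_add_le c (g x - c)
    rw [add_sub_cancel] at this
    linarith [h x hx]
  set z : H := T v - (c : ℂ) • (v : H) with hz
  have hzp : E.proj S z = z := by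
    rw [hz, map_sub, map_smul, hT.proj_apply_of_proj hgm hS v hv, hv]
  have hzd : z ∈ T.domain := hT.mem_domain_of_bounded hgm hS hzp hn
  rcases eq_or_ne ‖(v : H)‖ 0 with hv0 | hv0
  · have : v = 0 := Subtype.ext (by simpa using hv0)
    simp [hz, this]
  rcases eq_or_ne ‖z‖ 0 with hz0 | hz0
  · rw [hz0]
    have h0 := (abs_nonneg _).trans (hqb v hv)
    have : 0 < ‖(v : H)‖ := lt_of_le_of_ne (norm_nonneg _) hv0.symm
    nlinarith
  -- A symmetric form with `|q w| ≤ r ‖w‖²` has norm at most `r`. The test vector `u` is `z` scaled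
  -- to the norm of `v`: polarization gives `q (u + v) - q (u - v) = 4 ‖v‖ ‖z‖`, and the
  -- parallelogram law bounds this by `4 r ‖v‖²`.
  set t : ℝ := ‖(v : H)‖ / ‖z‖ with ht
  set u : T.domain := (t : ℂ) • ⟨z, hzd⟩ with hu
  have hup : E.proj S (u : H) = u := by
    rw [hu, Submodule.coe_smul, map_smul, hzp]
  have hun : ‖(u : H)‖ = ‖(v : H)‖ := by
    rw [hu, Submodule.coe_smul, norm_smul, Complex.norm_real, Real.norm_eq_abs,
      abs_of_nonneg (by positivity), ht]
    field_simp
  have hpol : q (u + v) - q (u - v) = 4 * (inner ℂ (u : H) z).re := by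
    have hsym : (inner ℂ (v : H) (T u - (c : ℂ) • (u : H))).re = (inner ℂ (u : H) z).re := by
      rw [hz, inner_sub_right, inner_sub_right, inner_apply_comm hT, ← inner_conj_symm (T v),
        inner_smul_right, inner_smul_right, ← inner_conj_symm (v : H) (u : H)]
      simp only [Complex.sub_re, Complex.conj_re, Complex.re_ofReal_mul]
    simp only [hq, LinearPMap.map_add, LinearPMap.map_sub, Submodule.coe_add, Submodule.coe_sub,
      smul_add, smul_sub, inner_add_left, inner_add_right, inner_sub_left, inner_sub_right,
      Complex.add_re, Complex.sub_re] at hsym ⊢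
    simp only [hz, inner_sub_right, Complex.sub_re] at hsym ⊢
    linarith
  have hpar := parallelogram_law_with_norm ℂ (u : H) (v : H)
  have b1 := hqb (u + v) (by rw [Submodule.coe_add, map_add, hup, hv])
  have b2 := hqb (u - v) (by rw [Submodule.coe_sub, map_sub, hup, hv])
  rw [Submodule.coe_add] at b1
  rw [Submodule.coe_sub] at b2
  have hin : (inner ℂ (u : H) z).re = t * ‖z‖ ^ 2 := by
    rw [hu, Submodule.coe_smul, inner_smul_left, Complex.conj_ofReal, Complex.re_ofReal_mul]
    congr 1
    simpa using inner_self_eq_norm_sq (𝕜 := ℂ) z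
  have ht2 : t * ‖z‖ ^ 2 = ‖(v : H)‖ * ‖z‖ := by rw [ht]; field_simp
  have hfin : ‖(v : H)‖ * ‖z‖ ≤ r * ‖(v : H)‖ ^ 2 := by
    have c1 := (abs_le.1 b1).2
    have c2 := (abs_le.1 b2).1
    rw [hun] at hpar
    have c3 : r * ‖(u : H) + v‖ ^ 2 + r * ‖(u : H) - v‖ ^ 2 = 4 * (r * ‖(v : H)‖ ^ 2) := by
      linear_combination r * hpar
    linarith
  have hvpos : 0 < ‖(v : H)‖ := lt_of_le_of_ne (norm_nonneg _) hv0.symm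
  nlinarith

/-- The spectral measure of `A` is concentrated on every Borel set containing the spectrum. -/
theorem proj_eq_self_of_spectrum_subset {A : H →ₗ.[ℂ] H}
    (hA : E.IsIntegral (fun x => (x : ℂ)) A) {F : Set ℝ} (hF : MeasurableSet F)
    (hs : unboundedSpectrum A ⊆ F) (v : H) : E.proj F v = v := by
  refine E.proj_eq_self_of_ae_mem hF (measure_null_of_locally_null _ fun r hr => ?_)
  have hr' : r ∉ unboundedSpectrum A := fun h => hr (hs h)
  simp only [unboundedSpectrum, mem_ofPred_eq, not_not] at hr'
  obtain ⟨R, hR, -⟩ := hr'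
  -- For `w` in the range of the projection of the ball of radius `ε`, `w = R (A - r) w` gives `‖w‖
  -- ≤ ‖R‖ ε ‖w‖ ≤ ‖w‖ / 2`. So every point off `F` has a null neighbourhood.
  set ε : ℝ := 1 / (2 * (‖R‖ + 1)) with hε
  have hεpos : 0 < ε := by positivity
  refine ⟨Metric.closedBall r ε, mem_nhdsWithin_of_mem_nhds (Metric.closedBall_mem_nhds r hεpos),
    ?_⟩
  have hB : MeasurableSet (Metric.closedBall r ε) := measurableSet_closedBall
  have hw := E.proj_proj_self hB v
  set w := E.proj (Metric.closedBall r ε) v with hwdef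
  have hwd : w ∈ A.domain := hA.mem_domain_of_bounded Complex.measurable_ofReal hB hw
    (r := |r| + ε) fun x hx => by
      have h1 : |x - r| ≤ ε := by simpa [Real.dist_eq] using hx
      rw [Complex.norm_real, Real.norm_eq_abs]
      have := abs_add_le r (x - r)
      rw [add_sub_cancel] at this
      linarith
  have h1 := norm_apply_sub_le (g := id) measurable_id hA hB (c := r) (r := ε)
    (fun x hx => by simpa [Real.dist_eq] using hx) ⟨w, hwd⟩ hw
  have h2 := hR ⟨w, hwd⟩
  have h3 := R.le_opNorm (A ⟨w, hwd⟩ - (r : ℂ) • w)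
  rw [h2] at h3
  dsimp only at h1 h3
  have h4 : ‖w‖ ≤ ‖R‖ * (ε * ‖w‖) := h3.trans (by gcongr)
  have h5 : ‖R‖ * ε ≤ 1 / 2 := by
    rw [hε, mul_one_div, div_le_div_iff₀ (by positivity) (by norm_num)]
    linarith [norm_nonneg R]
  have h6 : ‖w‖ = 0 := le_antisymm (by nlinarith [norm_nonneg w]) (norm_nonneg w)
  rw [E.scalarMeasure_apply hB, ← hwdef, h6]
  simp

end IsIntegral

end SpectralMeasure

end Spectral

/-! ### Sylvester estimates and dyadic cutting -/

section FormBounds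

variable {H : Type u} [NormedAddCommGroup H] [InnerProductSpace ℂ H] [CompleteSpace H]

/-- The form `(u, v) ↦ ⟪T₁ u, v⟫ + σ ⟪u, T₂ v⟫` is bounded by `c` on `ran E₁(S₁) × ran E₂(S₂)`. -/
def FormBound (E₁ E₂ : SpectralMeasure H) (T₁ T₂ : H →ₗ.[ℂ] H) (σ : ℂ) (S₁ S₂ : Set ℝ) (c : ℝ) :
    Prop :=
  ∀ (u : T₁.domain) (v : T₂.domain), E₁.proj S₁ u = u → E₂.proj S₂ v = v →
    ‖inner ℂ (T₁ u) (v : H) + σ * inner ℂ (u : H) (T₂ v)‖ ≤ c * ‖(u : H)‖ * ‖(v : H)‖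

namespace FormBound

variable {E₁ E₂ : SpectralMeasure H} {T₁ T₂ : H →ₗ.[ℂ] H} {σ : ℂ} {S₁ S₂ : Set ℝ}

theorem mono {S₁' S₂' : Set ℝ} {c c' : ℝ} (h : FormBound E₁ E₂ T₁ T₂ σ S₁ S₂ c)
    (hS₁ : MeasurableSet S₁) (hS₂ : MeasurableSet S₂) (hS₁' : MeasurableSet S₁')
    (hS₂' : MeasurableSet S₂') (h₁ : S₁' ⊆ S₁) (h₂ : S₂' ⊆ S₂) (hc : c ≤ c') :
    FormBound E₁ E₂ T₁ T₂ σ S₁' S₂' c' := fun u v hu hv =>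
  (h u v (E₁.proj_eq_self_mono hS₁' hS₁ h₁ hu) (E₂.proj_eq_self_mono hS₂' hS₂ h₂ hv)).trans
    (by gcongr)

theorem of_left_empty {c : ℝ} (h : S₁ = ∅) : FormBound E₁ E₂ T₁ T₂ σ S₁ S₂ c := by
  intro u v hu _
  have hu0 : u = 0 := Subtype.ext (by rw [← hu, h, E₁.proj_empty]; rfl)
  simp [hu0]

theorem of_right_empty {c : ℝ} (h : S₂ = ∅) : FormBound E₁ E₂ T₁ T₂ σ S₁ S₂ c := by
  intro u v _ hv
  have hv0 : v = 0 := Subtype.ext (by rw [← hv, h, E₂.proj_empty]; rfl)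
  simp [hv0]

variable {g : ℝ → ℝ}

/-- A `2 × 2` block form is bounded by the bound of its diagonal plus that of its off-diagonal. -/
theorem block {f : ℝ → ℂ} (h₁ : E₁.IsIntegral f T₁) (h₂ : E₂.IsIntegral f T₂)
    {S₁' S₂' : Set ℝ} {c d : ℝ}
    (hS₁ : MeasurableSet S₁) (hS₂ : MeasurableSet S₂) (hS₁' : MeasurableSet S₁')
    (hS₂' : MeasurableSet S₂') (hd₁ : Disjoint S₁ S₁') (hd₂ : Disjoint S₂ S₂')
    (hc : 0 ≤ c) (hd : 0 ≤ d)
    (b₁₁ : FormBound E₁ E₂ T₁ T₂ σ S₁ S₂ c) (b₂₂ : FormBound E₁ E₂ T₁ T₂ σ S₁' S₂' c)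
    (b₁₂ : FormBound E₁ E₂ T₁ T₂ σ S₁ S₂' d) (b₂₁ : FormBound E₁ E₂ T₁ T₂ σ S₁' S₂ d) :
    FormBound E₁ E₂ T₁ T₂ σ (S₁ ∪ S₁') (S₂ ∪ S₂') (c + d) := by
  intro u v hu hv
  have pyth : ∀ (E : SpectralMeasure H) {S S' : Set ℝ} (w : H), MeasurableSet S →
      MeasurableSet S' → Disjoint S S' → E.proj (S ∪ S') w = w →
      ‖E.proj S w‖ ^ 2 + ‖E.proj S' w‖ ^ 2 = ‖w‖ ^ 2 := by
    intro E S S' w hS hS' hdis hw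
    have := norm_add_sq_eq_norm_sq_add_norm_sq_of_inner_eq_zero (𝕜 := ℂ) (E.proj S w)
      (E.proj S' w) (by
        rw [E.inner_proj_left hS, E.proj_proj_of_disjoint hS' hS hdis.symm, inner_zero_right])
    rw [← E.proj_union hS hS' hdis, hw] at this
    linarith
  have pu := pyth E₁ (u : H) hS₁ hS₁' hd₁ hu
  have pv := pyth E₂ (v : H) hS₂ hS₂' hd₂ hv
  set u₁ : T₁.domain := ⟨_, h₁.proj_mem_domain hS₁ u.2⟩ with hu₁
  set u₂ : T₁.domain := ⟨_, h₁.proj_mem_domain hS₁' u.2⟩ with hu₂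
  set v₁ : T₂.domain := ⟨_, h₂.proj_mem_domain hS₂ v.2⟩ with hv₁
  set v₂ : T₂.domain := ⟨_, h₂.proj_mem_domain hS₂' v.2⟩ with hv₂
  have eu : u = u₁ + u₂ := Subtype.ext (by
    rw [Submodule.coe_add, ← E₁.proj_union hS₁ hS₁' hd₁, hu])
  have ev : v = v₁ + v₂ := Subtype.ext (by
    rw [Submodule.coe_add, ← E₂.proj_union hS₂ hS₂' hd₂, hv])
  have pu₁ : E₁.proj S₁ u₁ = u₁ := E₁.proj_proj_self hS₁ _
  have pu₂ : E₁.proj S₁' u₂ = u₂ := E₁.proj_proj_self hS₁' _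
  have pv₁ : E₂.proj S₂ v₁ = v₁ := E₂.proj_proj_self hS₂ _
  have pv₂ : E₂.proj S₂' v₂ = v₂ := E₂.proj_proj_self hS₂' _
  have n₁₁ := b₁₁ u₁ v₁ pu₁ pv₁
  have n₂₂ := b₂₂ u₂ v₂ pu₂ pv₂
  have n₁₂ := b₁₂ u₁ v₂ pu₁ pv₂
  have n₂₁ := b₂₁ u₂ v₁ pu₂ pv₁
  have expand : inner ℂ (T₁ u) (v : H) + σ * inner ℂ (u : H) (T₂ v) =
      ((inner ℂ (T₁ u₁) (v₁ : H) + σ * inner ℂ (u₁ : H) (T₂ v₁)) +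
        (inner ℂ (T₁ u₂) (v₂ : H) + σ * inner ℂ (u₂ : H) (T₂ v₂))) +
      ((inner ℂ (T₁ u₁) (v₂ : H) + σ * inner ℂ (u₁ : H) (T₂ v₂)) +
        (inner ℂ (T₁ u₂) (v₁ : H) + σ * inner ℂ (u₂ : H) (T₂ v₁))) := by
    conv_lhs => rw [eu, ev]
    simp only [LinearPMap.map_add, Submodule.coe_add, inner_add_left, inner_add_right]
    ring
  -- Cauchy–Schwarz in the plane, applied once to the diagonal pair of blocks and once to the
  -- off-diagonal pair. This is why each pair contributes its common bound once and not twice.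
  have cs : ∀ {a b a' b' x y : ℝ}, 0 ≤ x → 0 ≤ y → a ^ 2 + b ^ 2 = x ^ 2 → a' ^ 2 + b' ^ 2 = y ^ 2 →
      a * a' + b * b' ≤ x * y := by
    intro a b a' b' x y hx hy h h'
    refine abs_le_of_sq_le_sq' ?_ (by positivity) |>.2
    have : (x * y) ^ 2 = (a * a' + b * b') ^ 2 + (a * b' - b * a') ^ 2 := by
      rw [mul_pow, ← h, ← h']; ring
    rw [this]
    linarith [sq_nonneg (a * b' - b * a')]
  have c₁ : ‖(u₁ : H)‖ * ‖(v₁ : H)‖ + ‖(u₂ : H)‖ * ‖(v₂ : H)‖ ≤ ‖(u : H)‖ * ‖(v : H)‖ :=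
    cs (norm_nonneg _) (norm_nonneg _) pu pv
  have c₂ : ‖(u₁ : H)‖ * ‖(v₂ : H)‖ + ‖(u₂ : H)‖ * ‖(v₁ : H)‖ ≤ ‖(u : H)‖ * ‖(v : H)‖ :=
    cs (norm_nonneg _) (norm_nonneg _) pu (by rw [add_comm]; exact pv)
  rw [expand]
  refine (norm_add_le _ _).trans ((add_le_add (norm_add_le _ _) (norm_add_le _ _)).trans ?_)
  have m₁ := mul_le_mul_of_nonneg_left c₁ hc
  have m₂ := mul_le_mul_of_nonneg_left c₂ hd
  linarith

/-- If `T₁ X + X T₂` is bounded by `δ`, where `p ≤ T₁ ≤ N` and `q ≤ T₂ ≤ N`, then `X` is bounded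
by `δ / (p + q)`. -/
theorem norm_inner_le_of_bounded (hg : Measurable g)
    (h₁ : E₁.IsIntegral (fun x => (g x : ℂ)) T₁) (h₂ : E₂.IsIntegral (fun x => (g x : ℂ)) T₂)
    (hS₁ : MeasurableSet S₁) (hS₂ : MeasurableSet S₂) {δ p q N : ℝ} (hδ : 0 ≤ δ)
    (hp : 0 ≤ p) (hq : 0 ≤ q) (hpq : 0 < p + q) (hpN : p ≤ N) (hqN : q ≤ N)
    (hb : FormBound E₁ E₂ T₁ T₂ 1 S₁ S₂ δ) (hgS₁ : ∀ x ∈ S₁, p ≤ g x ∧ g x ≤ N)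
    (hgS₂ : ∀ x ∈ S₂, q ≤ g x ∧ g x ≤ N) {u v : H} (hu : E₁.proj S₁ u = u)
    (hv : E₂.proj S₂ v = v) : (p + q) * ‖inner ℂ u v‖ ≤ δ * ‖u‖ * ‖v‖ := by
  have hgm : Measurable fun x => (g x : ℂ) := Complex.measurable_ofReal.comp hg
  set X : H →L[ℂ] H := E₁.proj S₁ ∘L E₂.proj S₂ with hX
  have hXb : ∀ {u v : H}, E₁.proj S₁ u = u → E₂.proj S₂ v = v →
      ‖inner ℂ u v‖ ≤ ‖X‖ * ‖u‖ * ‖v‖ := by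
    intro u v hu hv
    have : inner ℂ u v = inner ℂ u (X v) := by
      conv_lhs => rw [← hu, ← hv]
      rw [E₁.inner_proj_left hS₁]
      rfl
    rw [this]
    calc _ ≤ ‖u‖ * ‖X v‖ := norm_inner_le_norm _ _
      _ ≤ ‖u‖ * (‖X‖ * ‖v‖) := by gcongr; exact X.le_opNorm v
      _ = _ := by ring
  have hN : 0 < N := by linarith
  have bd : ∀ {g : ℝ} {p : ℝ}, 0 ≤ p → p ≤ g ∧ g ≤ N → ‖(g : ℂ)‖ ≤ N := by
    intro g p hp h
    rw [Complex.norm_real, Real.norm_eq_abs, abs_of_nonneg (hp.trans h.1)]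
    exact h.2
  have bd' : ∀ {g : ℝ} {p : ℝ}, p ≤ g ∧ g ≤ N → |g - N| ≤ N - p := by
    intro g p h
    rw [abs_sub_comm, abs_of_nonneg (by linarith [h.2])]
    linarith [h.1]
  -- Write `2N X = (T₁ X + X T₂) + (N - T₁) X + X (N - T₂)`, where `‖N - T₁‖ ≤ N - p` and `‖N - T₂‖
  -- ≤ N - q`. The resulting bound contains `‖X‖` with the factor `(2N - p - q) / (2N) < 1`, so it
  -- can be absorbed in `hXn'`.
  have step : ∀ {u v : H}, E₁.proj S₁ u = u → E₂.proj S₂ v = v →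
      ‖inner ℂ u v‖ ≤ (δ + (2 * N - p - q) * ‖X‖) / (2 * N) * ‖u‖ * ‖v‖ := by
    intro u v hu hv
    have hud : u ∈ T₁.domain := h₁.mem_domain_of_bounded hgm hS₁ hu fun x hx => bd hp (hgS₁ x hx)
    have hvd : v ∈ T₂.domain := h₂.mem_domain_of_bounded hgm hS₂ hv fun x hx => bd hq (hgS₂ x hx)
    have n₁ := SpectralMeasure.IsIntegral.norm_apply_sub_le hg h₁ hS₁
      (fun x hx => bd' (hgS₁ x hx)) ⟨u, hud⟩ hu
    have n₂ := SpectralMeasure.IsIntegral.norm_apply_sub_le hg h₂ hS₂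
      (fun x hx => bd' (hgS₂ x hx)) ⟨v, hvd⟩ hv
    have r₁ : E₁.proj S₁ (T₁ ⟨u, hud⟩ - (N : ℂ) • u) = T₁ ⟨u, hud⟩ - (N : ℂ) • u := by
      rw [map_sub, map_smul, h₁.proj_apply_of_proj hgm hS₁ ⟨u, hud⟩ hu, hu]
    have r₂ : E₂.proj S₂ (T₂ ⟨v, hvd⟩ - (N : ℂ) • v) = T₂ ⟨v, hvd⟩ - (N : ℂ) • v := by
      rw [map_sub, map_smul, h₂.proj_apply_of_proj hgm hS₂ ⟨v, hvd⟩ hv, hv]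
    have i₁ := hXb r₁ hv
    have i₂ := hXb hu r₂
    have i₃ := hb ⟨u, hud⟩ ⟨v, hvd⟩ hu hv
    dsimp only at n₁ n₂ i₃
    have e : (2 * N : ℂ) * inner ℂ u v = (inner ℂ (T₁ ⟨u, hud⟩) v + 1 * inner ℂ u (T₂ ⟨v, hvd⟩)) -
        inner ℂ (T₁ ⟨u, hud⟩ - (N : ℂ) • u) v - inner ℂ u (T₂ ⟨v, hvd⟩ - (N : ℂ) • v) := by
      rw [inner_sub_left, inner_sub_right, inner_smul_left, inner_smul_right, Complex.conj_ofReal]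
      ring
    have e' : 2 * N * ‖inner ℂ u v‖ = ‖(2 * N : ℂ) * inner ℂ u v‖ := by
      rw [norm_mul, norm_mul, Complex.norm_real, Real.norm_eq_abs, abs_of_pos hN]
      simp
    have k₁ : ‖X‖ * ‖T₁ ⟨u, hud⟩ - (N : ℂ) • u‖ * ‖v‖ ≤ ‖X‖ * ((N - p) * ‖u‖) * ‖v‖ := by gcongr
    have k₂ : ‖X‖ * ‖u‖ * ‖T₂ ⟨v, hvd⟩ - (N : ℂ) • v‖ ≤ ‖X‖ * ‖u‖ * ((N - q) * ‖v‖) := by gcongr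
    have tot : 2 * N * ‖inner ℂ u v‖ ≤ (δ + (2 * N - p - q) * ‖X‖) * ‖u‖ * ‖v‖ := by
      rw [e', e]
      refine (norm_sub_le _ _).trans ((add_le_add_left (norm_sub_le _ _) _).trans ?_)
      linarith
    rw [div_mul_eq_mul_div, div_mul_eq_mul_div, le_div_iff₀ (by positivity)]
    linarith
  have hcoef : 0 ≤ (δ + (2 * N - p - q) * ‖X‖) / (2 * N) := by
    have : 0 ≤ 2 * N - p - q := by linarith
    positivity
  have hXn : ‖X‖ ≤ (δ + (2 * N - p - q) * ‖X‖) / (2 * N) := by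
    refine X.opNorm_le_bound hcoef fun w => ?_
    have h := step (u := X w) (v := E₂.proj S₂ w) (E₁.proj_proj_self hS₁ _)
      (E₂.proj_proj_self hS₂ _)
    have e : inner ℂ (X w) (E₂.proj S₂ w) = inner ℂ (X w) (X w) := by
      conv_lhs => rw [show X w = E₁.proj S₁ (X w) from (E₁.proj_proj_self hS₁ _).symm]
      rw [E₁.inner_proj_left hS₁]
      rfl
    rw [e, inner_self_eq_norm_sq_to_K, norm_pow] at h
    have h' : ‖X w‖ ^ 2 ≤ (δ + (2 * N - p - q) * ‖X‖) / (2 * N) * ‖X w‖ * ‖w‖ := by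
      refine le_trans (by simp) (h.trans ?_)
      gcongr
      exact E₂.norm_proj_le hS₂ w
    rcases (norm_nonneg (X w)).eq_or_lt with h0 | h0
    · rw [← h0]; positivity
    · nlinarith
  have hXn' : (p + q) * ‖X‖ ≤ δ := by
    rw [le_div_iff₀ (by positivity)] at hXn
    linarith
  calc (p + q) * ‖inner ℂ u v‖ ≤ (p + q) * (‖X‖ * ‖u‖ * ‖v‖) := by gcongr; exact hXb hu hv
    _ = (p + q) * ‖X‖ * (‖u‖ * ‖v‖) := by ring
    _ ≤ δ * (‖u‖ * ‖v‖) := by gcongr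
    _ = _ := by ring

/-- If `T₁ X + X T₂` is bounded by `δ`, where `p ≤ T₁` and `q ≤ T₂`, then `X` is bounded by
`δ / (p + q)`. -/
theorem norm_inner_le (hg : Measurable g)
    (h₁ : E₁.IsIntegral (fun x => (g x : ℂ)) T₁) (h₂ : E₂.IsIntegral (fun x => (g x : ℂ)) T₂)
    (hS₁ : MeasurableSet S₁) (hS₂ : MeasurableSet S₂) {δ p q : ℝ} (hδ : 0 ≤ δ)
    (hp : 0 ≤ p) (hq : 0 ≤ q) (hpq : 0 < p + q)
    (hb : FormBound E₁ E₂ T₁ T₂ 1 S₁ S₂ δ) (hgS₁ : ∀ x ∈ S₁, p ≤ g x)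
    (hgS₂ : ∀ x ∈ S₂, q ≤ g x) {u v : H} (hu : E₁.proj S₁ u = u)
    (hv : E₂.proj S₂ v = v) : (p + q) * ‖inner ℂ u v‖ ≤ δ * ‖u‖ * ‖v‖ := by
  -- Truncate to `g ≤ n`, apply the bounded case and let `n` tend to infinity. Its upper bound is
  -- `max n (max p q)` because `n` alone may be smaller than `p` or `q`.
  set s : ℕ → Set ℝ := fun n => {x | g x ≤ n} with hs
  have hsm : ∀ n, MeasurableSet (s n) := fun n => measurableSet_le hg measurable_const
  have hmono : Monotone s := fun m n hmn x hx =>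
    le_trans (b := (m : ℝ)) hx (by exact_mod_cast hmn)
  have hU : ⋃ n, s n = univ := eq_univ_of_forall fun x => mem_iUnion.2 (exists_nat_ge (g x))
  have l₁ := E₁.tendsto_proj hsm hmono hU u
  have l₂ := E₂.tendsto_proj hsm hmono hU v
  refine le_of_tendsto_of_tendsto' ((l₁.inner l₂).norm.const_mul (p + q))
    ((l₁.norm.const_mul δ).mul l₂.norm) fun n => ?_
  have r : ∀ (E : SpectralMeasure H) {S : Set ℝ} {w : H}, MeasurableSet S → E.proj S w = w →
      E.proj (S ∩ s n) (E.proj (s n) w) = E.proj (s n) w := by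
    intro E S w hS hw
    conv_lhs => rw [← hw, E.proj_proj hS (hsm n), E.proj_proj_self (hS.inter (hsm n)),
      ← E.proj_proj hS (hsm n), hw]
  exact norm_inner_le_of_bounded hg h₁ h₂ (hS₁.inter (hsm n)) (hS₂.inter (hsm n)) hδ hp hq hpq
    (N := max n (max p q)) ((le_max_left _ _).trans (le_max_right _ _))
    ((le_max_right _ _).trans (le_max_right _ _))
    (hb.mono hS₁ hS₂ (hS₁.inter (hsm n)) (hS₂.inter (hsm n)) inter_subset_left inter_subset_left
      le_rfl)
    (fun x hx => ⟨hgS₁ x hx.1, le_trans hx.2 (le_max_left _ _)⟩)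
    (fun x hx => ⟨hgS₂ x hx.1, le_trans hx.2 (le_max_left _ _)⟩) (r E₁ hS₁ hu) (r E₂ hS₂ hv)

/-- The Sylvester estimate with `T₂ v` in place of `v`: the range of `E₂(S₂)` is invariant under
`T₂`, and `‖T₂ v‖ ≤ r ‖v‖` there. -/
theorem norm_inner_apply_right_le (hg : Measurable g)
    (h₁ : E₁.IsIntegral (fun x => (g x : ℂ)) T₁) (h₂ : E₂.IsIntegral (fun x => (g x : ℂ)) T₂)
    (hS₁ : MeasurableSet S₁) (hS₂ : MeasurableSet S₂) {δ p q r : ℝ} (hδ : 0 ≤ δ)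
    (hp : 0 ≤ p) (hq : 0 ≤ q) (hpq : 0 < p + q)
    (hb : FormBound E₁ E₂ T₁ T₂ 1 S₁ S₂ δ) (hgS₁ : ∀ x ∈ S₁, p ≤ g x)
    (hgS₂ : ∀ x ∈ S₂, q ≤ g x) (hr : ∀ x ∈ S₂, g x ≤ r) (u : T₁.domain) (v : T₂.domain)
    (hu : E₁.proj S₁ u = u) (hv : E₂.proj S₂ v = v) :
    (p + q) * ‖inner ℂ (u : H) (T₂ v)‖ ≤ r * δ * ‖(u : H)‖ * ‖(v : H)‖ := by
  have hgm : Measurable fun x => (g x : ℂ) := Complex.measurable_ofReal.comp hg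
  have n := SpectralMeasure.IsIntegral.norm_apply_sub_le hg h₂ hS₂ (c := 0) (r := r) (fun x hx => by
    rw [sub_zero, abs_of_nonneg (hq.trans (hgS₂ x hx))]
    exact hr x hx) v hv
  rw [Complex.ofReal_zero, zero_smul, sub_zero] at n
  have h := norm_inner_le hg h₁ h₂ hS₁ hS₂ hδ hp hq hpq hb hgS₁ hgS₂ hu
    (h₂.proj_apply_of_proj hgm hS₂ v hv)
  refine h.trans ?_
  calc δ * ‖(u : H)‖ * ‖T₂ v‖ ≤ δ * ‖(u : H)‖ * (r * ‖(v : H)‖) := by gcongr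
    _ = _ := by ring

theorem norm_inner_apply_left_le (hg : Measurable g)
    (h₁ : E₁.IsIntegral (fun x => (g x : ℂ)) T₁) (h₂ : E₂.IsIntegral (fun x => (g x : ℂ)) T₂)
    (hS₁ : MeasurableSet S₁) (hS₂ : MeasurableSet S₂) {δ p q r : ℝ} (hδ : 0 ≤ δ)
    (hp : 0 ≤ p) (hq : 0 ≤ q) (hpq : 0 < p + q)
    (hb : FormBound E₁ E₂ T₁ T₂ 1 S₁ S₂ δ) (hgS₁ : ∀ x ∈ S₁, p ≤ g x)
    (hgS₂ : ∀ x ∈ S₂, q ≤ g x) (hr : ∀ x ∈ S₁, g x ≤ r) (u : T₁.domain) (v : T₂.domain)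
    (hu : E₁.proj S₁ u = u) (hv : E₂.proj S₂ v = v) :
    (p + q) * ‖inner ℂ (T₁ u) (v : H)‖ ≤ r * δ * ‖(u : H)‖ * ‖(v : H)‖ := by
  have hgm : Measurable fun x => (g x : ℂ) := Complex.measurable_ofReal.comp hg
  have n := SpectralMeasure.IsIntegral.norm_apply_sub_le hg h₁ hS₁ (c := 0) (r := r) (fun x hx => by
    rw [sub_zero, abs_of_nonneg (hp.trans (hgS₁ x hx))]
    exact hr x hx) u hu
  rw [Complex.ofReal_zero, zero_smul, sub_zero] at n
  have h := norm_inner_le hg h₁ h₂ hS₁ hS₂ hδ hp hq hpq hb hgS₁ hgS₂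
    (h₁.proj_apply_of_proj hgm hS₁ u hu) hv
  refine h.trans ?_
  calc δ * ‖T₁ u‖ * ‖(v : H)‖ ≤ δ * (r * ‖(u : H)‖) * ‖(v : H)‖ := by gcongr
    _ = _ := by ring

/-- Spectra separated by `c`: first above, second below. -/
theorem diff_of_le_left (hg : Measurable g)
    (h₁ : E₁.IsIntegral (fun x => (g x : ℂ)) T₁) (h₂ : E₂.IsIntegral (fun x => (g x : ℂ)) T₂)
    (hS₁ : MeasurableSet S₁) (hS₂ : MeasurableSet S₂) {δ c : ℝ} (hδ : 0 ≤ δ) (hc : 0 < c)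
    (hb : FormBound E₁ E₂ T₁ T₂ 1 S₁ S₂ δ) (hgS₁ : ∀ x ∈ S₁, c ≤ g x)
    (hgS₂ : ∀ x ∈ S₂, 0 ≤ g x ∧ g x ≤ c) : FormBound E₁ E₂ T₁ T₂ (-1) S₁ S₂ (3 * δ) := by
  intro u v hu hv
  have k := norm_inner_apply_right_le hg h₁ h₂ hS₁ hS₂ hδ hc.le le_rfl (by linarith) hb hgS₁
    (fun x hx => (hgS₂ x hx).1) (fun x hx => (hgS₂ x hx).2) u v hu hv
  have k' : ‖inner ℂ (u : H) (T₂ v)‖ ≤ δ * ‖(u : H)‖ * ‖(v : H)‖ := by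
    refine le_of_mul_le_mul_left ?_ hc
    linarith
  have e : inner ℂ (T₁ u) (v : H) + (-1) * inner ℂ (u : H) (T₂ v) =
      (inner ℂ (T₁ u) (v : H) + 1 * inner ℂ (u : H) (T₂ v)) -
        (inner ℂ (u : H) (T₂ v) + inner ℂ (u : H) (T₂ v)) := by ring
  rw [e]
  refine (norm_sub_le _ _).trans ((add_le_add (hb u v hu hv) (norm_add_le _ _)).trans ?_)
  linarith

/-- Spectra separated by `c`: first below, second above. -/
theorem diff_of_le_right (hg : Measurable g)
    (h₁ : E₁.IsIntegral (fun x => (g x : ℂ)) T₁) (h₂ : E₂.IsIntegral (fun x => (g x : ℂ)) T₂)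
    (hS₁ : MeasurableSet S₁) (hS₂ : MeasurableSet S₂) {δ c : ℝ} (hδ : 0 ≤ δ) (hc : 0 < c)
    (hb : FormBound E₁ E₂ T₁ T₂ 1 S₁ S₂ δ) (hgS₁ : ∀ x ∈ S₁, 0 ≤ g x ∧ g x ≤ c)
    (hgS₂ : ∀ x ∈ S₂, c ≤ g x) : FormBound E₁ E₂ T₁ T₂ (-1) S₁ S₂ (3 * δ) := by
  intro u v hu hv
  have k := norm_inner_apply_left_le hg h₁ h₂ hS₁ hS₂ hδ le_rfl hc.le (by linarith) hb
    (fun x hx => (hgS₁ x hx).1) hgS₂ (fun x hx => (hgS₁ x hx).2) u v hu hv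
  have k' : ‖inner ℂ (T₁ u) (v : H)‖ ≤ δ * ‖(u : H)‖ * ‖(v : H)‖ := by
    refine le_of_mul_le_mul_left ?_ hc
    linarith
  have e : inner ℂ (T₁ u) (v : H) + (-1) * inner ℂ (u : H) (T₂ v) =
      (inner ℂ (T₁ u) (v : H) + inner ℂ (T₁ u) (v : H)) -
        (inner ℂ (T₁ u) (v : H) + 1 * inner ℂ (u : H) (T₂ v)) := by ring
  rw [e]
  refine (norm_sub_le _ _).trans ((add_le_add (norm_add_le _ _) (hb u v hu hv)).trans ?_)
  linarith

/-- Here `X` is bounded by `δ / (2p)`, so `T₁ X` and `X T₂` are each bounded by `κδ / 2`. -/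
theorem diff_of_near (hg : Measurable g)
    (h₁ : E₁.IsIntegral (fun x => (g x : ℂ)) T₁) (h₂ : E₂.IsIntegral (fun x => (g x : ℂ)) T₂)
    (hS₁ : MeasurableSet S₁) (hS₂ : MeasurableSet S₂) {δ p κ : ℝ} (hδ : 0 ≤ δ) (hp : 0 < p)
    (hb : FormBound E₁ E₂ T₁ T₂ 1 S₁ S₂ δ) (hgS₁ : ∀ x ∈ S₁, p ≤ g x ∧ g x ≤ p * κ)
    (hgS₂ : ∀ x ∈ S₂, p ≤ g x ∧ g x ≤ p * κ) : FormBound E₁ E₂ T₁ T₂ (-1) S₁ S₂ (κ * δ) := by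
  intro u v hu hv
  have k₁ := norm_inner_apply_left_le hg h₁ h₂ hS₁ hS₂ hδ hp.le hp.le (by linarith) hb
    (fun x hx => (hgS₁ x hx).1) (fun x hx => (hgS₂ x hx).1) (fun x hx => (hgS₁ x hx).2) u v hu hv
  have k₂ := norm_inner_apply_right_le hg h₁ h₂ hS₁ hS₂ hδ hp.le hp.le (by linarith) hb
    (fun x hx => (hgS₁ x hx).1) (fun x hx => (hgS₂ x hx).1) (fun x hx => (hgS₂ x hx).2) u v hu hv
  have e : inner ℂ (T₁ u) (v : H) + (-1) * inner ℂ (u : H) (T₂ v) =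
      inner ℂ (T₁ u) (v : H) - inner ℂ (u : H) (T₂ v) := by ring
  rw [e]
  refine (norm_sub_le _ _).trans (le_of_mul_le_mul_left ?_ hp)
  linarith

/-- Cutting both spectra at `c`. -/
theorem diff_of_cut (hg : Measurable g)
    (h₁ : E₁.IsIntegral (fun x => (g x : ℂ)) T₁) (h₂ : E₂.IsIntegral (fun x => (g x : ℂ)) T₂)
    {S₁' S₂' : Set ℝ} (hS₁ : MeasurableSet S₁) (hS₂ : MeasurableSet S₂)
    (hS₁' : MeasurableSet S₁') (hS₂' : MeasurableSet S₂') (hd₁ : Disjoint S₁ S₁')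
    (hd₂ : Disjoint S₂ S₂') {δ c d : ℝ} (hδ : 0 ≤ δ) (hc : 0 < c) (hd : 0 ≤ d)
    (hb : FormBound E₁ E₂ T₁ T₂ 1 (S₁ ∪ S₁') (S₂ ∪ S₂') δ)
    (hgS₁ : ∀ x ∈ S₁, 0 ≤ g x ∧ g x ≤ c) (hgS₂ : ∀ x ∈ S₂, 0 ≤ g x ∧ g x ≤ c)
    (hgS₁' : ∀ x ∈ S₁', c ≤ g x) (hgS₂' : ∀ x ∈ S₂', c ≤ g x)
    (b₁ : FormBound E₁ E₂ T₁ T₂ (-1) S₁ S₂ d) (b₂ : FormBound E₁ E₂ T₁ T₂ (-1) S₁' S₂' d) :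
    FormBound E₁ E₂ T₁ T₂ (-1) (S₁ ∪ S₁') (S₂ ∪ S₂') (d + 3 * δ) := by
  refine block h₁ h₂ hS₁ hS₂ hS₁' hS₂' hd₁ hd₂ hd (by positivity) b₁ b₂ ?_ ?_
  · exact diff_of_le_right hg h₁ h₂ hS₁ hS₂' hδ hc
      (hb.mono (hS₁.union hS₁') (hS₂.union hS₂') hS₁ hS₂' subset_union_left subset_union_right
        le_rfl) hgS₁ hgS₂'
  · exact diff_of_le_left hg h₁ h₂ hS₁' hS₂ hδ hc
      (hb.mono (hS₁.union hS₁') (hS₂.union hS₂') hS₁' hS₂ subset_union_right subset_union_left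
        le_rfl) hgS₁' hgS₂

/-- Induction on `n`, cutting `[p, p exp(2 ^ (n + 1))]` at its logarithmic midpoint `c`. Both halves
have logarithmic length `2 ^ n` and form the diagonal of a block form, so the bound grows only by
the `3δ` of the separated blocks. The base case is `diff_of_near` with `κ = e < 3`. -/
theorem diff_dyadic (hg : Measurable g)
    (h₁ : E₁.IsIntegral (fun x => (g x : ℂ)) T₁) (h₂ : E₂.IsIntegral (fun x => (g x : ℂ)) T₂)
    {δ : ℝ} (hδ : 0 ≤ δ) (n : ℕ) : ∀ {S₁ S₂ : Set ℝ} {p : ℝ}, MeasurableSet S₁ →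
    MeasurableSet S₂ → 0 < p → FormBound E₁ E₂ T₁ T₂ 1 S₁ S₂ δ →
    (∀ x ∈ S₁, p ≤ g x ∧ g x ≤ p * Real.exp (2 ^ n)) →
    (∀ x ∈ S₂, p ≤ g x ∧ g x ≤ p * Real.exp (2 ^ n)) →
    FormBound E₁ E₂ T₁ T₂ (-1) S₁ S₂ ((3 + 3 * n) * δ) := by
  induction n with
  | zero =>
    intro S₁ S₂ p hS₁ hS₂ hp hb hgS₁ hgS₂
    refine (diff_of_near hg h₁ h₂ hS₁ hS₂ hδ hp hb hgS₁ hgS₂).mono hS₁ hS₂ hS₁ hS₂ subset_rfl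
      subset_rfl ?_
    gcongr
    simpa using Real.exp_one_lt_three.le
  | succ n ih =>
    intro S₁ S₂ p hS₁ hS₂ hp hb hgS₁ hgS₂
    set c := p * Real.exp (2 ^ n) with hc
    have hcpos : 0 < c := by positivity
    have hcc : p * Real.exp (2 ^ (n + 1)) = c * Real.exp (2 ^ n) := by
      rw [hc, mul_assoc, ← Real.exp_add]
      ring_nf
    have hm : MeasurableSet {x | g x < c} := measurableSet_lt hg measurable_const
    have split : ∀ S : Set ℝ, (S ∩ {x | g x < c}) ∪ (S \ {x | g x < c}) = S := fun S =>
      inter_union_sdiff _ _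
    have hi₁ := hS₁.inter hm
    have hi₂ := hS₂.inter hm
    have hj₁ := hS₁.diff hm
    have hj₂ := hS₂.diff hm
    have hb' := hb
    rw [← split S₁, ← split S₂] at hb'
    have res := diff_of_cut hg h₁ h₂ hi₁ hi₂ hj₁ hj₂ disjoint_sdiff_inter.symm
      disjoint_sdiff_inter.symm hδ hcpos (d := (3 + 3 * n) * δ) (by positivity) hb'
      (fun x hx => ⟨hp.le.trans (hgS₁ x hx.1).1, le_of_lt hx.2⟩)
      (fun x hx => ⟨hp.le.trans (hgS₂ x hx.1).1, le_of_lt hx.2⟩)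
      (fun x hx => not_lt.1 hx.2) (fun x hx => not_lt.1 hx.2)
      (ih hi₁ hi₂ hp (hb.mono hS₁ hS₂ hi₁ hi₂ inter_subset_left inter_subset_left le_rfl)
        (fun x hx => ⟨(hgS₁ x hx.1).1, le_of_lt hx.2⟩)
        (fun x hx => ⟨(hgS₂ x hx.1).1, le_of_lt hx.2⟩))
      (ih hj₁ hj₂ hcpos (hb.mono hS₁ hS₂ hj₁ hj₂ sdiff_subset sdiff_subset le_rfl)
        (fun x hx => ⟨not_lt.1 hx.2, hcc ▸ (hgS₁ x hx.1).2⟩)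
        (fun x hx => ⟨not_lt.1 hx.2, hcc ▸ (hgS₂ x hx.1).2⟩))
    rw [split, split] at res
    convert res using 1
    push_cast
    ring

end FormBound

end FormBounds

/-! ### The upper bound for the operator Lipschitz norm -/

section UpperBound

theorem Set.OrdConnected.le_of_disjoint {α : Type*} [LinearOrder α] {J₁ J₂ : Set α}
    (hJ₁ : J₁.OrdConnected) (hJ₂ : J₂.OrdConnected) (hd : Disjoint J₁ J₂) {x y : α} (hx : x ∈ J₁)
    (hy : y ∈ J₂) (hxy : x ≤ y) {a b : α} (ha : a ∈ J₁) (hb : b ∈ J₂) : a ≤ b := by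
  by_contra! hlt
  rcases le_total x b with h | h
  · exact disjoint_left.1 hd (hJ₁.out hx ha ⟨h, hlt.le⟩) hb
  · exact disjoint_left.1 hd hx (hJ₂.out hb hy ⟨h, hxy⟩)

theorem sub_le_of_volume_log_le {K : Set ℝ} (hK : K.OrdConnected) (hpos : K ⊆ Ioi 0) {r : ℝ}
    (hr : 0 ≤ r) (hv : volume (Real.log '' K) ≤ ENNReal.ofReal r) {x y : ℝ} (hx : x ∈ K)
    (hy : y ∈ K) : Real.log y - Real.log x ≤ r := by
  have hsub : Icc (Real.log x) (Real.log y) ⊆ Real.log '' K := by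
    intro t ht
    refine ⟨Real.exp t, hK.out hx hy ⟨?_, ?_⟩, Real.log_exp t⟩
    · exact (Real.log_le_iff_le_exp (hpos hx)).1 ht.1
    · exact (Real.le_log_iff_exp_le (hpos hy)).1 ht.2
  have h := (measure_mono hsub).trans hv
  rw [Real.volume_Icc] at h
  exact (ENNReal.ofReal_le_ofReal_iff hr).1 h

variable {H : Type u} [NormedAddCommGroup H] [InnerProductSpace ℂ H] [CompleteSpace H]

namespace FormBound

variable {E₁ E₂ : SpectralMeasure H} {T₁ T₂ : H →ₗ.[ℂ] H} {g : ℝ → ℝ}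

/-- Disjoint intervals are separated by the supremum of the lower one. Otherwise cut at the
endpoints `α` and `β` of `J₁ ∩ J₂`: below `α`, and likewise above `β`, at most one of `J₁`, `J₂` has
points, so these diagonal blocks are trivial. The two cuts cost `3δ` each, on top of the `(3 + 3n)δ`
of the middle block. -/
theorem diff_of_intervals (hg : Measurable g)
    (h₁ : E₁.IsIntegral (fun x => (g x : ℂ)) T₁) (h₂ : E₂.IsIntegral (fun x => (g x : ℂ)) T₂)
    {S₁ S₂ J₁ J₂ : Set ℝ} (hS₁ : MeasurableSet S₁) (hS₂ : MeasurableSet S₂)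
    (hJ₁ : J₁.OrdConnected) (hJ₂ : J₂.OrdConnected) (hp₁ : J₁ ⊆ Ioi 0) (hp₂ : J₂ ⊆ Ioi 0)
    (hgS₁ : ∀ x ∈ S₁, g x ∈ J₁) (hgS₂ : ∀ x ∈ S₂, g x ∈ J₂) {n : ℕ}
    (hv : volume (Real.log '' (J₁ ∩ J₂)) ≤ ENNReal.ofReal (2 ^ n)) {δ : ℝ} (hδ : 0 ≤ δ)
    (hb : FormBound E₁ E₂ T₁ T₂ 1 S₁ S₂ δ) :
    FormBound E₁ E₂ T₁ T₂ (-1) S₁ S₂ ((9 + 3 * n) * δ) := by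
  have hpos₁ : ∀ x ∈ S₁, 0 < g x := fun x hx => hp₁ (hgS₁ x hx)
  have hpos₂ : ∀ x ∈ S₂, 0 < g x := fun x hx => hp₂ (hgS₂ x hx)
  rcases S₁.eq_empty_or_nonempty with he | ⟨x₁, hx₁⟩
  · exact of_left_empty he
  rcases S₂.eq_empty_or_nonempty with he | ⟨x₂, hx₂⟩
  · exact of_right_empty he
  have h3 : 3 * δ ≤ (9 + 3 * n) * δ := by
    gcongr
    linarith [(Nat.cast_nonneg n : (0 : ℝ) ≤ n)]
  rcases (J₁ ∩ J₂).eq_empty_or_nonempty with hK | ⟨k, hk⟩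
  · have hd : Disjoint J₁ J₂ := disjoint_iff_inter_eq_empty.2 hK
    rcases le_total (g x₁) (g x₂) with h | h
    · have hle : ∀ {a b}, a ∈ J₁ → b ∈ J₂ → a ≤ b := fun ha hb =>
        hJ₁.le_of_disjoint hJ₂ hd (hgS₁ _ hx₁) (hgS₂ _ hx₂) h ha hb
      have hbdd : BddAbove J₁ := ⟨g x₂, fun a ha => hle ha (hgS₂ _ hx₂)⟩
      refine (diff_of_le_right hg h₁ h₂ hS₁ hS₂ hδ (c := sSup J₁) ?_ hb ?_ ?_).mono hS₁ hS₂ hS₁ hS₂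
        subset_rfl subset_rfl h3
      · exact (hpos₁ _ hx₁).trans_le (le_csSup hbdd (hgS₁ _ hx₁))
      · exact fun x hx => ⟨(hpos₁ x hx).le, le_csSup hbdd (hgS₁ x hx)⟩
      · exact fun x hx => csSup_le ⟨_, hgS₁ _ hx₁⟩ fun a ha => hle ha (hgS₂ x hx)
    · have hle : ∀ {a b}, a ∈ J₂ → b ∈ J₁ → a ≤ b := fun ha hb =>
        hJ₂.le_of_disjoint hJ₁ hd.symm (hgS₂ _ hx₂) (hgS₁ _ hx₁) h ha hb
      have hbdd : BddAbove J₂ := ⟨g x₁, fun a ha => hle ha (hgS₁ _ hx₁)⟩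
      refine (diff_of_le_left hg h₁ h₂ hS₁ hS₂ hδ (c := sSup J₂) ?_ hb ?_ ?_).mono hS₁ hS₂ hS₁ hS₂
        subset_rfl subset_rfl h3
      · exact (hpos₂ _ hx₂).trans_le (le_csSup hbdd (hgS₂ _ hx₂))
      · exact fun x hx => csSup_le ⟨_, hgS₂ _ hx₂⟩ fun a ha => hle ha (hgS₁ x hx)
      · exact fun x hx => ⟨(hpos₂ x hx).le, le_csSup hbdd (hgS₂ x hx)⟩
  have hKp : J₁ ∩ J₂ ⊆ Ioi 0 := inter_subset_left.trans hp₁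
  have hlen : ∀ {x y}, x ∈ J₁ ∩ J₂ → y ∈ J₁ ∩ J₂ → Real.log y - Real.log x ≤ 2 ^ n := fun hx hy =>
    sub_le_of_volume_log_le (hJ₁.inter hJ₂) hKp (by positivity) hv hx hy
  set M := Real.log '' (J₁ ∩ J₂) with hM
  have hMne : M.Nonempty := ⟨_, mem_image_of_mem _ hk⟩
  have hbelow : BddBelow M := ⟨Real.log k - 2 ^ n, by
    rintro _ ⟨x, hx, rfl⟩
    linarith [hlen hx hk]⟩
  have habove : BddAbove M := ⟨Real.log k + 2 ^ n, by
    rintro _ ⟨x, hx, rfl⟩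
    linarith [hlen hk hx]⟩
  set α := Real.exp (sInf M) with hα
  set β := Real.exp (sSup M) with hβ
  have hαK : ∀ x ∈ J₁ ∩ J₂, α ≤ x := fun x hx =>
    (Real.le_log_iff_exp_le (hKp hx)).1 (csInf_le hbelow (mem_image_of_mem _ hx))
  have hβK : ∀ x ∈ J₁ ∩ J₂, x ≤ β := fun x hx =>
    (Real.log_le_iff_le_exp (hKp hx)).1 (le_csSup habove (mem_image_of_mem _ hx))
  have hαpos : 0 < α := Real.exp_pos _
  have hβpos : 0 < β := Real.exp_pos _
  have hαβ : β ≤ α * Real.exp (2 ^ n) := by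
    rw [hα, hβ, ← Real.exp_add, Real.exp_le_exp]
    have : ∀ y ∈ M, y - 2 ^ n ≤ sInf M := by
      rintro _ ⟨y, hy, rfl⟩
      refine le_csInf hMne ?_
      rintro _ ⟨x, hx, rfl⟩
      linarith [hlen hx hy]
    exact csSup_le hMne fun y hy => by linarith [this y hy]
  have hlow : ∀ x ∈ J₁, ∀ y ∈ J₂, x < α → y < α → False := by
    intro x hx y hy hxα hyα
    have hkα := hαK k hk
    have : max x y ∈ J₁ ∩ J₂ :=
      ⟨hJ₁.out hx hk.1 ⟨le_max_left _ _, (max_lt hxα hyα).le.trans hkα⟩,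
        hJ₂.out hy hk.2 ⟨le_max_right _ _, (max_lt hxα hyα).le.trans hkα⟩⟩
    exact absurd (hαK _ this) (not_le.2 (max_lt hxα hyα))
  have hhigh : ∀ x ∈ J₁, ∀ y ∈ J₂, β < x → β < y → False := by
    intro x hx y hy hxβ hyβ
    have hkβ := hβK k hk
    have : min x y ∈ J₁ ∩ J₂ :=
      ⟨hJ₁.out hk.1 hx ⟨hkβ.trans (lt_min hxβ hyβ).le, min_le_left _ _⟩,
        hJ₂.out hk.2 hy ⟨hkβ.trans (lt_min hxβ hyβ).le, min_le_right _ _⟩⟩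
    exact absurd (hβK _ this) (not_le.2 (lt_min hxβ hyβ))
  have vac : ∀ {A B : Set ℝ} {c : ℝ}, (∀ x ∈ A, ∀ y ∈ B, False) →
      FormBound E₁ E₂ T₁ T₂ (-1) A B c := by
    intro A B c h
    rcases A.eq_empty_or_nonempty with he | ⟨x, hx⟩
    · exact of_left_empty he
    · exact of_right_empty (eq_empty_of_forall_notMem fun y hy => h x hx y hy)
  have hmα : MeasurableSet {x | g x < α} := measurableSet_lt hg measurable_const
  have hmβ : MeasurableSet {x | g x ≤ β} := measurableSet_le hg measurable_const
  have middle : ∀ {R₁ R₂ : Set ℝ}, MeasurableSet R₁ → MeasurableSet R₂ → R₁ ⊆ S₁ → R₂ ⊆ S₂ →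
      (∀ x ∈ R₁, α ≤ g x) → (∀ x ∈ R₂, α ≤ g x) →
      FormBound E₁ E₂ T₁ T₂ (-1) R₁ R₂ ((3 + 3 * n) * δ + 3 * δ) := by
    intro R₁ R₂ hR₁ hR₂ hs₁ hs₂ ha₁ ha₂
    have hbR : FormBound E₁ E₂ T₁ T₂ 1 R₁ R₂ δ := hb.mono hS₁ hS₂ hR₁ hR₂ hs₁ hs₂ le_rfl
    have hbR' := hbR
    have hi₁ := hR₁.inter hmβ
    have hi₂ := hR₂.inter hmβ
    have hj₁ := hR₁.diff hmβ
    have hj₂ := hR₂.diff hmβ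
    have split : ∀ S : Set ℝ, (S ∩ {x | g x ≤ β}) ∪ (S \ {x | g x ≤ β}) = S := fun S =>
      inter_union_sdiff _ _
    rw [← split R₁, ← split R₂] at hbR'
    have res := diff_of_cut hg h₁ h₂ hi₁ hi₂ hj₁ hj₂ disjoint_sdiff_inter.symm
      disjoint_sdiff_inter.symm hδ hβpos (d := (3 + 3 * n) * δ) (by positivity) hbR'
      (fun x hx => ⟨(hpos₁ x (hs₁ hx.1)).le, hx.2⟩)
      (fun x hx => ⟨(hpos₂ x (hs₂ hx.1)).le, hx.2⟩)
      (fun x hx => (not_le.1 hx.2).le) (fun x hx => (not_le.1 hx.2).le)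
      (diff_dyadic hg h₁ h₂ hδ n hi₁ hi₂ hαpos
        (hbR.mono hR₁ hR₂ hi₁ hi₂ inter_subset_left inter_subset_left le_rfl)
        (fun x hx => ⟨ha₁ x hx.1, le_trans hx.2 hαβ⟩)
        (fun x hx => ⟨ha₂ x hx.1, le_trans hx.2 hαβ⟩))
      (vac fun x hx y hy => hhigh _ (hgS₁ x (hs₁ hx.1)) _ (hgS₂ y (hs₂ hy.1)) (not_le.1 hx.2)
        (not_le.1 hy.2))
    rwa [split, split] at res
  have hi₁ := hS₁.inter hmα
  have hi₂ := hS₂.inter hmα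
  have hj₁ := hS₁.diff hmα
  have hj₂ := hS₂.diff hmα
  have split : ∀ S : Set ℝ, (S ∩ {x | g x < α}) ∪ (S \ {x | g x < α}) = S := fun S =>
    inter_union_sdiff _ _
  have hb' := hb
  rw [← split S₁, ← split S₂] at hb'
  have res := diff_of_cut hg h₁ h₂ hi₁ hi₂ hj₁ hj₂ disjoint_sdiff_inter.symm
    disjoint_sdiff_inter.symm hδ hαpos (d := (3 + 3 * n) * δ + 3 * δ) (by positivity) hb'
    (fun x hx => ⟨(hpos₁ x hx.1).le, le_of_lt hx.2⟩)
    (fun x hx => ⟨(hpos₂ x hx.1).le, le_of_lt hx.2⟩)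
    (fun x hx => not_lt.1 hx.2) (fun x hx => not_lt.1 hx.2)
    (vac fun x hx y hy => hlow _ (hgS₁ x hx.1) _ (hgS₂ y hy.1) hx.2 hy.2)
    (middle hj₁ hj₂ sdiff_subset sdiff_subset (fun x hx => not_lt.1 hx.2)
      (fun x hx => not_lt.1 hx.2))
  rw [split, split] at res
  convert res using 1
  ring

end FormBound

/-- The constant is `1` for the diagonal blocks, where `|x| = ±x` with a common sign, plus `9 + 3n`
for the off-diagonal ones. -/
theorem isOperatorLipschitzWith_abs {J₁ J₂ : Set ℝ} (hJ₁ : J₁.OrdConnected)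
    (hJ₂ : J₂.OrdConnected) (hp₁ : J₁ ⊆ Ioi 0) (hp₂ : J₂ ⊆ Ioi 0) {n : ℕ}
    (hv : volume (Real.log '' (J₁ ∩ J₂)) ≤ ENNReal.ofReal (2 ^ n)) :
    IsOperatorLipschitzWith.{u} (fun x => ((|x| : ℝ) : ℂ)) (-J₁ ∪ J₂) (10 + 3 * n) := by
  intro H _ _ _ A B fA fB hA hB sA sB ⟨E₁, a₁, t₁⟩ ⟨E₂, a₂, t₂⟩ δ ⟨hdom, hAB⟩
  have hid : Measurable fun x : ℝ => (x : ℂ) := Complex.measurable_ofReal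
  have hgm : Measurable fun x : ℝ => ((|x| : ℝ) : ℂ) := hid.comp measurable_abs
  have hm₁ : MeasurableSet (-J₁) := hJ₁.measurableSet.neg
  have hm₂ : MeasurableSet J₂ := hJ₂.measurableSet
  have hdisj : Disjoint (-J₁) J₂ := by
    refine disjoint_left.2 fun x hx hx' => ?_
    have h1 : 0 < -x := hp₁ hx
    have h2 : 0 < x := hp₂ hx'
    linarith
  have dom_eq : ∀ {E : SpectralMeasure H} {T fT : H →ₗ.[ℂ] H}, E.IsIntegral (fun x => (x : ℂ)) T →
      E.IsIntegral (fun x => ((|x| : ℝ) : ℂ)) fT → fT.domain = T.domain := by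
    intro E T fT hT hfT
    ext v
    rw [hT.1, hfT.1]
    refine memLp_congr_norm hgm.aestronglyMeasurable hid.aestronglyMeasurable
      (Eventually.of_forall fun x => ?_)
    simp
  have hd₁ := dom_eq a₁ t₁
  have hd₂ := dom_eq a₂ t₂
  have sum_bound : ∀ (u : A.domain) (v : B.domain),
      ‖inner ℂ (A u) (v : H) - inner ℂ (u : H) (B v)‖ ≤ δ * ‖(u : H)‖ * ‖(v : H)‖ := by
    intro u v
    have hvA : (v : H) ∈ A.domain := by rw [hdom]; exact v.2
    have e : inner ℂ (A u) (v : H) = inner ℂ (u : H) (A ⟨v, hvA⟩) :=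
      (SpectralMeasure.IsIntegral.inner_apply_comm (g := id) a₁ u ⟨v, hvA⟩).symm
    rw [e, ← inner_sub_right]
    calc _ ≤ ‖(u : H)‖ * ‖A ⟨v, hvA⟩ - B v‖ := norm_inner_le_norm _ _
      _ ≤ ‖(u : H)‖ * (δ * ‖(v : H)‖) := by gcongr; exact hAB v hvA v.2
      _ = _ := by ring
  have val : ∀ {E : SpectralMeasure H} {T fT : H →ₗ.[ℂ] H} {S : Set ℝ} {ε : ℂ},
      E.IsIntegral (fun x => (x : ℂ)) T → E.IsIntegral (fun x => ((|x| : ℝ) : ℂ)) fT →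
      MeasurableSet S → (∀ x ∈ S, ((|x| : ℝ) : ℂ) = ε * x) → ∀ (v : H), E.proj S v = v →
      ∀ (h : v ∈ fT.domain) (h' : v ∈ T.domain), fT ⟨v, h⟩ = ε • T ⟨v, h'⟩ :=
    fun hT hfT hS hε v hv h h' => hfT.apply_eq_smul hT hgm hid hS _ hε hv h h'
  have posJ : ∀ x ∈ J₂, ((|x| : ℝ) : ℂ) = 1 * x := fun x hx => by
    rw [abs_of_pos (hp₂ hx), one_mul]
  have negJ : ∀ x ∈ -J₁, ((|x| : ℝ) : ℂ) = (-1) * x := fun x hx => by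
    have : 0 < -x := hp₁ hx
    rw [abs_of_neg (by linarith)]
    push_cast
    ring
  -- One computation serves all four blocks: equal signs `ε = ε'` go with the difference `σ = -1`,
  -- opposite signs with the sum `σ = 1`.
  have blk : ∀ {S S' : Set ℝ} {ε ε' σ : ℂ}, MeasurableSet S → MeasurableSet S' →
      (∀ x ∈ S, ((|x| : ℝ) : ℂ) = ε * x) → (∀ x ∈ S', ((|x| : ℝ) : ℂ) = ε' * x) →
      (starRingEnd ℂ) ε = -(σ * ε') → ‖ε‖ = 1 → FormBound E₁ E₂ fA fB σ S S' δ := by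
    intro S S' ε ε' σ hS hS' hε hε' hc hn u v hu hv
    have huA : (u : H) ∈ A.domain := by rw [← hd₁]; exact u.2
    have hvB : (v : H) ∈ B.domain := by rw [← hd₂]; exact v.2
    have e₁ : fA u = ε • A ⟨u, huA⟩ := val a₁ t₁ hS hε u hu u.2 huA
    have e₂ : fB v = ε' • B ⟨v, hvB⟩ := val a₂ t₂ hS' hε' v hv v.2 hvB
    have e : inner ℂ (fA u) (v : H) + σ * inner ℂ (u : H) (fB v) =
        (starRingEnd ℂ) ε * (inner ℂ (A ⟨u, huA⟩) (v : H) - inner ℂ (u : H) (B ⟨v, hvB⟩)) := by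
      rw [e₁, e₂, inner_smul_left, inner_smul_right, hc]
      ring
    rw [e, norm_mul, RCLike.norm_conj, hn, one_mul]
    exact sum_bound ⟨u, huA⟩ ⟨v, hvB⟩
  have absJ₁ : ∀ x ∈ -J₁, |x| ∈ J₁ := fun x hx => by
    have h0 : 0 < -x := hp₁ hx
    rw [abs_of_neg (by linarith)]
    exact hx
  have absJ₂ : ∀ x ∈ J₂, |x| ∈ J₂ := fun x hx => by rwa [abs_of_pos (hp₂ hx)]
  have hδ : (0 : ℝ) ≤ δ := δ.2
  have total : FormBound E₁ E₂ fA fB (-1) (-J₁ ∪ J₂) (-J₁ ∪ J₂) (δ + (9 + 3 * n) * δ) := by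
    refine FormBound.block t₁ t₂ hm₁ hm₁ hm₂ hm₂ hdisj hdisj hδ (by positivity)
      (blk hm₁ hm₁ negJ negJ (by simp) (by simp)) (blk hm₂ hm₂ posJ posJ (by simp) (by simp)) ?_ ?_
    · exact FormBound.diff_of_intervals measurable_abs t₁ t₂ hm₁ hm₂ hJ₁ hJ₂ hp₁ hp₂ absJ₁ absJ₂ hv
        hδ (blk hm₁ hm₂ negJ posJ (by simp) (by simp))
    · exact FormBound.diff_of_intervals measurable_abs t₁ t₂ hm₂ hm₁ hJ₂ hJ₁ hp₂ hp₁ absJ₂ absJ₁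
        (by rwa [inter_comm]) hδ (blk hm₂ hm₁ posJ negJ (by simp) (by simp))
  have hF : MeasurableSet (-J₁ ∪ J₂) := hm₁.union hm₂
  refine ⟨by rw [hd₁, hd₂, hdom], fun v hvA hvB => ?_⟩
  have key : ∀ u : fA.domain, ‖inner ℂ (u : H) (fA ⟨v, hvA⟩ - fB ⟨v, hvB⟩)‖ ≤
      (δ + (9 + 3 * n) * δ) * ‖(u : H)‖ * ‖v‖ := by
    intro u
    have h := total u ⟨v, hvB⟩ (a₁.proj_eq_self_of_spectrum_subset hF sA u)
      (a₂.proj_eq_self_of_spectrum_subset hF sB v)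
    have e : inner ℂ (u : H) (fA ⟨v, hvA⟩) = inner ℂ (fA u) v :=
      SpectralMeasure.IsIntegral.inner_apply_comm (g := fun x => |x|) t₁ u ⟨v, hvA⟩
    rw [inner_sub_right, e]
    refine le_of_eq_of_le ?_ h
    congr 1
    ring
  -- The form bound needs `u` in the domain of `fA`; by density it holds for every `u`, in
  -- particular for the difference vector itself.
  have key' : ∀ u : H, ‖inner ℂ u (fA ⟨v, hvA⟩ - fB ⟨v, hvB⟩)‖ ≤
      (δ + (9 + 3 * n) * δ) * ‖u‖ * ‖v‖ := by
    intro u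
    refine (t₁.dense_domain hgm).induction (P := fun u => ‖inner ℂ u (fA ⟨v, hvA⟩ - fB ⟨v, hvB⟩)‖ ≤
      (δ + (9 + 3 * n) * δ) * ‖u‖ * ‖v‖) (fun w hw => key ⟨w, hw⟩) ?_ u
    exact isClosed_le (by fun_prop) (by fun_prop)
  have hz := key' (fA ⟨v, hvA⟩ - fB ⟨v, hvB⟩)
  set z := fA ⟨v, hvA⟩ - fB ⟨v, hvB⟩
  rw [inner_self_eq_norm_sq_to_K, norm_pow] at hz
  have hz' : ‖z‖ ^ 2 ≤ (δ + (9 + 3 * n) * δ) * ‖z‖ * ‖v‖ := le_trans (by simp) hz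
  push_cast
  rcases (norm_nonneg z).eq_or_lt with h0 | h0
  · rw [← h0]; positivity
  · refine le_of_mul_le_mul_left ?_ h0
    linarith

end UpperBound

/-! ### Diagonal operators in finite dimension and the commutator bound -/

section DiagonalOperators

variable {H : Type u} [NormedAddCommGroup H] [InnerProductSpace ℂ H]
  {ι : Type*} [Fintype ι]

/-- The operator which is diagonal in the orthonormal basis `b`, with eigenvalues `c`. -/
noncomputable def diagOp (b : OrthonormalBasis ι ℂ H) (c : ι → ℂ) : H →L[ℂ] H :=
  ∑ i, c i • InnerProductSpace.rankOne ℂ (b i) (b i)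

theorem diagOp_apply (b : OrthonormalBasis ι ℂ H) (c : ι → ℂ) (v : H) :
    diagOp b c v = ∑ i, (c i * b.repr v i) • b i := by
  simp [diagOp, b.repr_apply_apply, mul_smul]

theorem repr_diagOp (b : OrthonormalBasis ι ℂ H) (c : ι → ℂ) (v : H) (i : ι) :
    b.repr (diagOp b c v) i = c i * b.repr v i := by
  classical
  rw [diagOp_apply, b.repr_apply_apply, b.orthonormal.inner_right_fintype]

theorem diagOp_ext {b : OrthonormalBasis ι ℂ H} {v w : H} (h : ∀ i, b.repr v i = b.repr w i) :
    v = w := b.repr.injective (by ext i; exact h i)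

theorem diagOp_diagOp (b : OrthonormalBasis ι ℂ H) (c c' : ι → ℂ) (v : H) :
    diagOp b c (diagOp b c' v) = diagOp b (fun i => c i * c' i) v :=
  diagOp_ext (b := b) fun i => by simp only [repr_diagOp, mul_assoc]

theorem diagOp_one (b : OrthonormalBasis ι ℂ H) : diagOp b (fun _ => 1) = 1 := by
  ext v
  exact diagOp_ext (b := b) fun i => by simp [repr_diagOp]

theorem diagOp_const (b : OrthonormalBasis ι ℂ H) (c : ℂ) (v : H) :
    diagOp b (fun _ => c) v = c • v :=
  diagOp_ext (b := b) fun i => by simp [repr_diagOp]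

theorem inner_diagOp (b : OrthonormalBasis ι ℂ H) (c : ι → ℂ) (v : H) :
    inner ℂ v (diagOp b c v) = ∑ i, c i * (‖b.repr v i‖ ^ 2 : ℝ) := by
  rw [← b.repr.inner_map_map, PiLp.inner_apply]
  refine Finset.sum_congr rfl fun i _ => ?_
  rw [repr_diagOp, RCLike.inner_apply, mul_assoc, Complex.mul_conj, Complex.normSq_eq_norm_sq]

theorem unboundedSpectrum_diagOp_subset (b : OrthonormalBasis ι ℂ H) (l : ι → ℝ) :
    unboundedSpectrum ((diagOp b fun i => (l i : ℂ)).toPMap ⊤) ⊆ range l := by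
  intro r hr
  by_contra hl
  refine hr ⟨diagOp b fun i => ((l i : ℂ) - r)⁻¹, fun v => ?_, fun w => ⟨Submodule.mem_top, ?_⟩⟩
  all_goals
    refine diagOp_ext (b := b) fun i => ?_
    have hne : (l i : ℂ) - r ≠ 0 := by
      rw [sub_ne_zero]
      exact fun h => hl ⟨i, by exact_mod_cast h⟩
  · change b.repr (diagOp b _ (diagOp b _ (v : H) - (r : ℂ) • (v : H))) i = _
    rw [repr_diagOp, map_sub, map_smul, PiLp.sub_apply, PiLp.smul_apply, repr_diagOp, smul_eq_mul]
    field_simp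
  · change b.repr (diagOp b _ (diagOp b _ w) - (r : ℂ) • diagOp b _ w) i = _
    rw [map_sub, map_smul, PiLp.sub_apply, PiLp.smul_apply, repr_diagOp, repr_diagOp, smul_eq_mul]
    field_simp

variable [CompleteSpace H]

theorem star_diagOp (b : OrthonormalBasis ι ℂ H) (c : ι → ℂ) :
    star (diagOp b c) = diagOp b (fun i => star (c i)) := by
  simp [diagOp, star_sum, star_smul, ContinuousLinearMap.star_eq_adjoint]

theorem hasSum_indicator_one {s : ℕ → Set ℝ} (hd : Pairwise (Function.onFun Disjoint s)) (x : ℝ) :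
    HasSum (fun n => (s n).indicator (1 : ℝ → ℂ) x) ((⋃ n, s n).indicator (1 : ℝ → ℂ) x) := by
  by_cases h : ∃ n, x ∈ s n
  · obtain ⟨n, hn⟩ := h
    have e : (⋃ n, s n).indicator (1 : ℝ → ℂ) x = (s n).indicator 1 x := by
      rw [indicator_of_mem hn, indicator_of_mem (mem_iUnion.2 ⟨n, hn⟩)]
    rw [e]
    refine hasSum_single n fun m hm => indicator_of_notMem (fun hm' => ?_) _
    exact disjoint_left.1 (hd hm) hm' hn
  · rw [indicator_of_notMem (by simpa using h)]
    push Not at h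
    simp_rw [fun n => indicator_of_notMem (h n) (1 : ℝ → ℂ)]
    exact hasSum_zero

/-- The spectral measure of the diagonal operator with real eigenvalues `l`. -/
noncomputable def diagSpectralMeasure (b : OrthonormalBasis ι ℂ H) (l : ι → ℝ) :
    SpectralMeasure H where
  proj s := diagOp b fun i => s.indicator (1 : ℝ → ℂ) (l i)
  isStarProjection s _ := by
    refine ⟨?_, ?_⟩
    · ext v
      rw [mul_apply_eq_comp, diagOp_diagOp]
      refine diagOp_ext (b := b) fun i => ?_
      by_cases h : l i ∈ s <;> simp [repr_diagOp, h]
    · rw [IsSelfAdjoint, star_diagOp]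
      congr 1
      ext i
      by_cases h : l i ∈ s <;> simp [h]
  proj_univ := by simpa using diagOp_one b
  hasSum_proj s _ hd v := by
    simp_rw [diagOp_apply]
    exact hasSum_sum fun i _ => ((hasSum_indicator_one hd (l i)).mul_right _).smul_const _

theorem diagSpectralMeasure_scalarMeasure (b : OrthonormalBasis ι ℂ H) (l : ι → ℝ) (v : H) :
    (diagSpectralMeasure b l).scalarMeasure v =
      ∑ i, ENNReal.ofReal (‖b.repr v i‖ ^ 2) • Measure.dirac (l i) := by
  ext s hs
  rw [SpectralMeasure.scalarMeasure_apply _ hs, ← SpectralMeasure.re_inner_proj _ hs]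
  change ENNReal.ofReal (inner ℂ v (diagOp b _ v)).re = _
  rw [inner_diagOp, Complex.re_sum, ENNReal.ofReal_sum_of_nonneg, Measure.finsetSum_apply]
  · refine Finset.sum_congr rfl fun i _ => ?_
    rw [Measure.smul_apply, Measure.dirac_apply' _ hs]
    by_cases h : l i ∈ s
    · rw [indicator_of_mem h, indicator_of_mem h]
      simp only [Pi.one_apply, one_mul, mul_one, Complex.ofReal_re, smul_eq_mul]
    · simp [h]
  · intro i _
    by_cases h : l i ∈ s <;> simp [h]
    norm_cast
    positivity

theorem isIntegral_diagOp (b : OrthonormalBasis ι ℂ H) (l : ι → ℝ) {f : ℝ → ℂ}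
    (hf : Measurable f) : (diagSpectralMeasure b l).IsIntegral f
      ((diagOp b fun i => f (l i)).toPMap ⊤) := by
  have hbd : ∀ v : H, MemLp f 2 ((diagSpectralMeasure b l).scalarMeasure v) := by
    intro v
    refine MemLp.of_bound hf.aestronglyMeasurable (∑ i, ‖f (l i)‖) ?_
    have hm : MeasurableSet (range l) := (finite_range l).measurableSet
    have h1 : (diagSpectralMeasure b l).proj (range l) v = v := by
      change diagOp b _ v = v
      exact diagOp_ext (b := b) fun i => by simp [repr_diagOp]
    filter_upwards [SpectralMeasure.ae_mem_of_proj_eq_self _ hm h1] with x hx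
    obtain ⟨i, rfl⟩ := hx
    exact Finset.single_le_sum (f := fun i => ‖f (l i)‖) (fun _ _ => norm_nonneg _)
      (Finset.mem_univ i)
  refine ⟨fun v => ⟨fun _ => hbd v, fun _ => Submodule.mem_top⟩, fun v => ?_⟩
  change inner ℂ (v : H) (diagOp b _ (v : H)) = _
  rw [inner_diagOp, diagSpectralMeasure_scalarMeasure, integral_finsetSum_measure]
  · refine Finset.sum_congr rfl fun i _ => ?_
    rw [integral_smul_measure, integral_dirac, ENNReal.toReal_ofReal (by positivity),
      Complex.real_smul, mul_comm]
  · intro i _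
    exact (integrable_dirac (by simp)).smul_measure ENNReal.ofReal_ne_top

theorem isSelfAdjoint_diagOp (b : OrthonormalBasis ι ℂ H) (l : ι → ℝ) :
    IsSelfAdjoint ((diagOp b fun i => (l i : ℂ)).toPMap ⊤) := by
  rw [LinearPMap.isSelfAdjoint_def,
    ContinuousLinearMap.toPMap_adjoint_eq_adjoint_toPMap_of_dense _ (by simp),
    ← ContinuousLinearMap.star_eq_adjoint, star_diagOp]
  simp

theorem IsOperatorLipschitzWith.norm_diagOp_sub_le {f : ℝ → ℂ} {F : Set ℝ} {C : ℝ≥0}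
    (h : IsOperatorLipschitzWith.{u} f F C) (hf : Measurable f) (b b' : OrthonormalBasis ι ℂ H)
    {l l' : ι → ℝ} (hl : ∀ i, l i ∈ F) (hl' : ∀ i, l' i ∈ F) :
    ‖diagOp b (fun i => f (l i)) - diagOp b' (fun i => f (l' i))‖ ≤
      C * ‖diagOp b (fun i => (l i : ℂ)) - diagOp b' (fun i => (l' i : ℂ))‖ := by
  have key := h H _ _ _ _ (isSelfAdjoint_diagOp b l) (isSelfAdjoint_diagOp b' l')
    ((unboundedSpectrum_diagOp_subset b l).trans (range_subset_iff.2 hl))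
    ((unboundedSpectrum_diagOp_subset b' l').trans (range_subset_iff.2 hl'))
    ⟨_, isIntegral_diagOp b l Complex.measurable_ofReal, isIntegral_diagOp b l hf⟩
    ⟨_, isIntegral_diagOp b' l' Complex.measurable_ofReal, isIntegral_diagOp b' l' hf⟩
    ‖diagOp b (fun i => (l i : ℂ)) - diagOp b' (fun i => (l' i : ℂ))‖₊
    ⟨rfl, fun v _ _ => ContinuousLinearMap.le_opNorm
      (diagOp b (fun i => (l i : ℂ)) - diagOp b' (fun i => (l' i : ℂ))) v⟩
  exact ContinuousLinearMap.opNorm_le_bound _ (by positivity) fun v =>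
    key.2 v Submodule.mem_top Submodule.mem_top

/-- Operator Lipschitz functions are commutator Lipschitz. -/
theorem IsOperatorLipschitzWith.norm_commutator_le {f : ℝ → ℂ} {F : Set ℝ} {C : ℝ≥0}
    (h : IsOperatorLipschitzWith.{u} f F C) (hf : Measurable f) (b : OrthonormalBasis ι ℂ H)
    {l : ι → ℝ} (hl : ∀ i, l i ∈ F) {K : H →L[ℂ] H} (hK : star K = -K) :
    ‖K * diagOp b (fun i => f (l i)) - diagOp b (fun i => f (l i)) * K‖ ≤
      C * ‖K * diagOp b (fun i => (l i : ℂ)) - diagOp b (fun i => (l i : ℂ)) * K‖ := by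
  let +nondep : NormedAlgebra ℚ (H →L[ℂ] H) := .restrictScalars ℚ ℂ _
  set e : ℝ → (H →L[ℂ] H) := fun t => NormedSpace.exp (t • K) with he
  have hstar : ∀ t, star (e t) = NormedSpace.exp (t • -K) := by
    intro t
    rw [he]
    dsimp only
    rw [NormedSpace.star_exp, star_smul, hK, star_trivial]
  have hu : ∀ t, e t ∈ unitary (H →L[ℂ] H) := fun t =>
    NormedSpace.exp_mem_unitary_of_mem_skewAdjoint (by
      rw [skewAdjoint.mem_iff, star_smul, hK, star_trivial, smul_neg])
  -- Conjugation by the unitary `e t` is the same as moving the basis, so the Lipschitz bound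
  -- applies to `e t D (e t)⁻¹` and `D`, which have the same eigenvalues. Dividing by `t` and
  -- letting `t → 0` yields the commutators.
  have hconj : ∀ (t : ℝ) (c : ι → ℂ),
      diagOp (b.map (Unitary.linearIsometryEquiv ⟨e t, hu t⟩)) c =
        e t * diagOp b c * NormedSpace.exp (t • -K) := by
    intro t c
    rw [← hstar]
    ext v
    rw [mul_apply_eq_comp, mul_apply_eq_comp, diagOp_apply, diagOp_apply, map_sum]
    refine Finset.sum_congr rfl fun i _ => ?_
    rw [map_smul]
    rfl
  have hder : ∀ c : ι → ℂ, HasDerivAt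
      (fun t => e t * diagOp b c * NormedSpace.exp (t • -K)) (K * diagOp b c - diagOp b c * K) 0 := by
    intro c
    have h1 := hasDerivAt_exp_smul_const (𝕂 := ℝ) K (0 : ℝ)
    have h2 := hasDerivAt_exp_smul_const (𝕂 := ℝ) (-K) (0 : ℝ)
    convert! (h1.mul_const (diagOp b c)).mul h2 using 1
    simp [sub_eq_add_neg]
  have hlim := fun c => (hder c).tendsto_slope_zero.norm
  have he0 : e 0 = 1 := by simp [he]
  refine le_of_tendsto_of_tendsto' (hlim _) ((hlim _).const_mul (C : ℝ)) fun t => ?_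
  have k := h.norm_diagOp_sub_le hf (b.map (Unitary.linearIsometryEquiv ⟨e t, hu t⟩)) b hl hl
  rw [hconj, hconj] at k
  simp only [zero_add, he0, zero_smul, NormedSpace.exp_zero, one_mul, mul_one, norm_smul]
  calc _ ≤ ‖t⁻¹‖ * (C * _) := by gcongr
    _ = _ := by ring

end DiagonalOperators

/-! ### Hilbert's inequality -/

section HilbertMatrix

theorem integral_exp_two_pi_I_mul (m : ℤ) :
    ∫ x in (0 : ℝ)..1, Complex.exp (2 * Real.pi * Complex.I * m * x) = if m = 0 then 1 else 0 := by
  split_ifs with h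
  · simp [h]
  · have hc : 2 * Real.pi * Complex.I * m ≠ 0 := by
      simp [Real.pi_ne_zero, Complex.I_ne_zero, h]
    rw [integral_exp_mul_complex hc]
    have : Complex.exp (2 * Real.pi * Complex.I * m) = 1 :=
      Complex.exp_eq_one_iff.2 ⟨m, by ring⟩
    simp [this]

/-- The Fourier coefficients of the sawtooth are the entries of the Hilbert matrix. For `m = 0` both
sides vanish, the right one by `1 / 0 = 0`, so the matrix has zero diagonal. -/
theorem integral_sub_half_mul_exp (m : ℤ) :
    ∫ x in (0 : ℝ)..1, ((x : ℂ) - 1 / 2) * Complex.exp (2 * Real.pi * Complex.I * m * x) =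
      1 / (2 * Real.pi * Complex.I * m) := by
  set c : ℂ := 2 * Real.pi * Complex.I * m with hc
  have hexp : Complex.exp c = 1 := Complex.exp_eq_one_iff.2 ⟨m, by rw [hc]; ring⟩
  rcases eq_or_ne c 0 with h | h
  · have hd : ∀ x ∈ uIcc (0 : ℝ) 1, HasDerivAt (fun x : ℝ => ((x : ℂ) ^ 2 - x) / 2)
        ((x : ℂ) - 1 / 2) x := by
      intro x _
      have h1 : HasDerivAt (fun x : ℝ => (x : ℂ)) 1 x := Complex.ofRealCLM.hasDerivAt
      convert! ((h1.pow 2).sub h1).div_const 2 using 1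
      push_cast
      ring
    have := intervalIntegral.integral_eq_sub_of_hasDerivAt hd
      (Continuous.intervalIntegrable (by fun_prop) _ _)
    simp only [h, zero_mul, Complex.exp_zero, mul_one, div_zero]
    rw [this]
    simp
  · have hd : ∀ x ∈ uIcc (0 : ℝ) 1, HasDerivAt
        (fun x : ℝ => (((x : ℂ) - 1 / 2) / c - 1 / c ^ 2) * Complex.exp (c * x))
        (((x : ℂ) - 1 / 2) * Complex.exp (c * x)) x := by
      intro x _
      have h1 : HasDerivAt (fun x : ℝ => (x : ℂ)) 1 x := Complex.ofRealCLM.hasDerivAt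
      convert! (((h1.sub_const (1 / 2)).div_const c).sub_const (1 / c ^ 2)).mul
        ((h1.const_mul c).cexp) using 1
      field_simp
      ring
    rw [intervalIntegral.integral_eq_sub_of_hasDerivAt hd
      (Continuous.intervalIntegrable (by fun_prop) _ _)]
    simp only [Complex.ofReal_one, Complex.ofReal_zero, mul_one, mul_zero, Complex.exp_zero, hexp]
    ring

theorem integral_norm_sq_trigPoly {n : ℕ} (a : Fin n → ℂ) (ε : ℤ) (hε : ε ≠ 0) :
    ∫ x in (0 : ℝ)..1, ‖∑ j, a j * Complex.exp (2 * Real.pi * Complex.I * ((ε * (j : ℕ) : ℤ)) * x)‖ ^ 2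
      = ∑ j, ‖a j‖ ^ 2 := by
  have hconj : ∀ (m : ℤ) (x : ℝ), (starRingEnd ℂ) (Complex.exp (2 * Real.pi * Complex.I * m * x)) =
      Complex.exp (2 * Real.pi * Complex.I * ((-m : ℤ)) * x) := by
    intro m x
    rw [← Complex.exp_conj]
    congr 1
    simp [Complex.conj_ofNat]
  have key : ∀ x : ℝ,
      ((‖∑ j, a j * Complex.exp (2 * Real.pi * Complex.I * ((ε * (j : ℕ) : ℤ)) * x)‖ ^ 2 : ℝ) : ℂ) =
      ∑ j : Fin n, ∑ k : Fin n, a j * (starRingEnd ℂ) (a k) *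
        Complex.exp (2 * Real.pi * Complex.I * ((ε * (j : ℕ) - ε * (k : ℕ) : ℤ)) * x) := by
    intro x
    rw [← Complex.normSq_eq_norm_sq, ← Complex.mul_conj, map_sum, Finset.sum_mul_sum]
    refine Finset.sum_congr rfl fun j _ => Finset.sum_congr rfl fun k _ => ?_
    rw [map_mul, hconj, mul_mul_mul_comm, ← Complex.exp_add]
    congr 2
    push_cast
    ring
  have : ((∫ x in (0 : ℝ)..1,
      ‖∑ j, a j * Complex.exp (2 * Real.pi * Complex.I * ((ε * (j : ℕ) : ℤ)) * x)‖ ^ 2 : ℝ) : ℂ) =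
      ((∑ j, ‖a j‖ ^ 2 : ℝ) : ℂ) := by
    rw [← intervalIntegral.integral_ofReal]
    simp_rw [key]
    rw [intervalIntegral.integral_finsetSum
      fun j _ => Continuous.intervalIntegrable (by fun_prop) _ _, Complex.ofReal_sum]
    refine Finset.sum_congr rfl fun j _ => ?_
    rw [intervalIntegral.integral_finsetSum
      fun k _ => Continuous.intervalIntegrable (by fun_prop) _ _]
    simp_rw [intervalIntegral.integral_const_mul, integral_exp_two_pi_I_mul]
    rw [Finset.sum_eq_single j]
    · rw [if_pos (sub_self _), mul_one, Complex.mul_conj, Complex.normSq_eq_norm_sq]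
    · intro k _ hk
      rw [if_neg, mul_zero]
      rw [← mul_sub]
      refine mul_ne_zero hε (sub_ne_zero.2 fun h => hk ?_)
      exact (Fin.ext (by exact_mod_cast h)).symm
    · simp
  exact_mod_cast this

/-- Hilbert's inequality. -/
theorem hilbert_inequality {n : ℕ} (a c : Fin n → ℂ) :
    ‖∑ j : Fin n, ∑ k : Fin n, (1 / (((j : ℕ) : ℂ) - ((k : ℕ) : ℂ))) * (a j * c k)‖ ≤
      Real.pi / 2 * (∑ j, ‖a j‖ ^ 2 + ∑ k, ‖c k‖ ^ 2) := by
  set P : ℝ → ℂ := fun x =>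
    ∑ j, a j * Complex.exp (2 * Real.pi * Complex.I * ((1 * (j : ℕ) : ℤ)) * x) with hP
  set Q : ℝ → ℂ := fun x =>
    ∑ k, c k * Complex.exp (2 * Real.pi * Complex.I * (((-1) * (k : ℕ) : ℤ)) * x) with hQ
  have hPc : Continuous P := by fun_prop
  have hQc : Continuous Q := by fun_prop
  -- The bilinear form is an integral of the product `P Q` against the sawtooth, which is at most `1
  -- / 2` in absolute value. Parseval for `P` and `Q` then gives `2π · 1/4 = π / 2`.
  have e : ∑ j : Fin n, ∑ k : Fin n, (1 / (((j : ℕ) : ℂ) - ((k : ℕ) : ℂ))) * (a j * c k) =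
      (2 * Real.pi * Complex.I) * ∫ x in (0 : ℝ)..1, ((x : ℂ) - 1 / 2) * (P x * Q x) := by
    have h1 : ∀ x : ℝ, ((x : ℂ) - 1 / 2) * (P x * Q x) = ∑ j : Fin n, ∑ k : Fin n, (a j * c k) *
        (((x : ℂ) - 1 / 2) *
          Complex.exp (2 * Real.pi * Complex.I * (((j : ℕ) - (k : ℕ) : ℤ)) * x)) := by
      intro x
      rw [hP, hQ]
      dsimp only
      rw [Finset.sum_mul_sum, Finset.mul_sum]
      refine Finset.sum_congr rfl fun j _ => ?_
      rw [Finset.mul_sum]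
      refine Finset.sum_congr rfl fun k _ => ?_
      have : Complex.exp (2 * Real.pi * Complex.I * (((j : ℕ) - (k : ℕ) : ℤ)) * x) =
          Complex.exp (2 * Real.pi * Complex.I * ((1 * (j : ℕ) : ℤ)) * x) *
          Complex.exp (2 * Real.pi * Complex.I * (((-1) * (k : ℕ) : ℤ)) * x) := by
        rw [← Complex.exp_add]
        congr 1
        push_cast
        ring
      rw [this]
      ring
    simp_rw [h1]
    rw [intervalIntegral.integral_finsetSum
      fun j _ => Continuous.intervalIntegrable (by fun_prop) _ _, Finset.mul_sum]
    refine Finset.sum_congr rfl fun j _ => ?_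
    rw [intervalIntegral.integral_finsetSum
      fun k _ => Continuous.intervalIntegrable (by fun_prop) _ _, Finset.mul_sum]
    refine Finset.sum_congr rfl fun k _ => ?_
    rw [intervalIntegral.integral_const_mul, integral_sub_half_mul_exp]
    have hpi : (2 * Real.pi * Complex.I : ℂ) ≠ 0 := by
      simp [Real.pi_ne_zero, Complex.I_ne_zero]
    push_cast
    rw [one_div, one_div, mul_inv (2 * Real.pi * Complex.I : ℂ)]
    field_simp
  have b : ‖∫ x in (0 : ℝ)..1, ((x : ℂ) - 1 / 2) * (P x * Q x)‖ ≤
      ∫ x in (0 : ℝ)..1, (1 / 4) * (‖P x‖ ^ 2 + ‖Q x‖ ^ 2) := by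
    refine intervalIntegral.norm_integral_le_of_norm_le zero_le_one
      (Eventually.of_forall fun x hx => ?_) (Continuous.intervalIntegrable (by fun_prop) _ _)
    have h1 : ‖(x : ℂ) - 1 / 2‖ ≤ 1 / 2 := by
      have : (x : ℂ) - 1 / 2 = ((x - 1 / 2 : ℝ) : ℂ) := by push_cast; ring
      rw [this, Complex.norm_real, Real.norm_eq_abs, abs_le]
      constructor <;> linarith [hx.1, hx.2]
    rw [norm_mul, norm_mul]
    have h2 : ‖P x‖ * ‖Q x‖ ≤ (1 / 2) * (‖P x‖ ^ 2 + ‖Q x‖ ^ 2) := by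
      linarith [two_mul_le_add_sq ‖P x‖ ‖Q x‖]
    calc _ ≤ (1 / 2) * ((1 / 2) * (‖P x‖ ^ 2 + ‖Q x‖ ^ 2)) := by gcongr
      _ = _ := by ring
  rw [intervalIntegral.integral_const_mul, intervalIntegral.integral_add
    (Continuous.intervalIntegrable (by fun_prop) _ _)
    (Continuous.intervalIntegrable (by fun_prop) _ _),
    integral_norm_sq_trigPoly a 1 one_ne_zero, integral_norm_sq_trigPoly c (-1) (by norm_num)] at b
  rw [e, norm_mul]
  have hn : ‖(2 * Real.pi * Complex.I : ℂ)‖ = 2 * Real.pi := by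
    simp [abs_of_pos Real.pi_pos]
  rw [hn]
  calc _ ≤ 2 * Real.pi * (1 / 4 * (∑ j, ‖a j‖ ^ 2 + ∑ k, ‖c k‖ ^ 2)) := by gcongr
    _ = _ := by ring

variable {H : Type u} [NormedAddCommGroup H] [InnerProductSpace ℂ H]

/-- The additive bound is tested with `x` equal to `N v` rescaled to the norm of `v`. -/
theorem ContinuousLinearMap.opNorm_le_of_inner_le (N : H →L[ℂ] H) {C : ℝ} (hC : 0 ≤ C)
    (h : ∀ x v, ‖inner ℂ x (N v)‖ ≤ C / 2 * (‖x‖ ^ 2 + ‖v‖ ^ 2)) : ‖N‖ ≤ C := by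
  refine N.opNorm_le_bound hC fun v => ?_
  rcases (norm_nonneg (N v)).eq_or_lt with h0 | h0
  · rw [← h0]; positivity
  have hv : 0 < ‖v‖ := by
    refine (norm_nonneg v).lt_of_ne fun h' => ?_
    rw [norm_eq_zero.1 h'.symm, map_zero, norm_zero] at h0
    exact lt_irrefl _ h0
  have k := h (((‖v‖ / ‖N v‖ : ℝ) : ℂ) • N v) v
  rw [inner_smul_left, norm_smul, norm_mul, inner_self_eq_norm_sq_to_K, norm_pow, RCLike.norm_conj,
    Complex.norm_real, Real.norm_eq_abs, abs_of_pos (by positivity), div_mul_cancel₀ _ h0.ne'] at k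
  have k2 : ‖v‖ / ‖N v‖ * ‖N v‖ ^ 2 ≤ C / 2 * (‖v‖ ^ 2 + ‖v‖ ^ 2) := le_trans (by simp) k
  have e : ‖v‖ / ‖N v‖ * ‖N v‖ ^ 2 = ‖v‖ * ‖N v‖ := by field_simp
  rw [e] at k2
  refine le_of_mul_le_mul_left ?_ hv
  linarith

/-- The Hilbert matrix has norm at most `π` with respect to any orthonormal families. -/
theorem norm_hilbertMatrix_le {n : ℕ} {e f : Fin n → H} (he : Orthonormal ℂ e)
    (hf : Orthonormal ℂ f) :
    ‖∑ j : Fin n, ∑ k : Fin n, (1 / (((j : ℕ) : ℂ) - ((k : ℕ) : ℂ))) • InnerProductSpace.rankOne ℂ (e j) (f k)‖ ≤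
      Real.pi := by
  refine ContinuousLinearMap.opNorm_le_of_inner_le _ Real.pi_pos.le fun x v => ?_
  have h := hilbert_inequality (fun j => inner ℂ x (e j)) (fun k => inner ℂ (f k) v)
  have h1 : ∑ j, ‖inner ℂ x (e j)‖ ^ 2 ≤ ‖x‖ ^ 2 := by
    simp_rw [norm_inner_symm x]
    exact he.sum_inner_products_le x
  have h2 : ∑ k, ‖inner ℂ (f k) v‖ ^ 2 ≤ ‖v‖ ^ 2 := hf.sum_inner_products_le v
  have e1 : inner ℂ x ((∑ j : Fin n, ∑ k : Fin n, (1 / (((j : ℕ) : ℂ) - ((k : ℕ) : ℂ))) •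
      InnerProductSpace.rankOne ℂ (e j) (f k)) v) =
      ∑ j : Fin n, ∑ k : Fin n, (1 / (((j : ℕ) : ℂ) - ((k : ℕ) : ℂ))) * (inner ℂ x (e j) * inner ℂ (f k) v) := by
    simp only [sum_apply, inner_sum]
    refine Finset.sum_congr rfl fun j _ => Finset.sum_congr rfl fun k _ => ?_
    rw [smul_apply, InnerProductSpace.rankOne_apply, inner_smul_right, inner_smul_right]
    ring
  rw [e1]
  refine h.trans ?_
  have := Real.pi_pos
  gcongr

end HilbertMatrix

/-! ### Harmonic sums -/

theorem sum_range_harmonic (n : ℕ) :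
    ∑ j ∈ Finset.range n, harmonic j = n * harmonic n - n := by
  induction n with
  | zero => simp
  | succ n ih =>
    rw [Finset.sum_range_succ, ih, harmonic_succ]
    push_cast
    field_simp
    ring

theorem sum_range_inv_sub_eq_harmonic (j : ℕ) :
    ∑ k ∈ Finset.range j, (1 / ((j : ℝ) - k)) = harmonic j := by
  rw [← Finset.sum_range_reflect, harmonic, Rat.cast_sum]
  refine Finset.sum_congr rfl fun k hk => ?_
  have hk' : k < j := Finset.mem_range.1 hk
  rw [show j - 1 - k = j - (k + 1) by omega, Nat.cast_sub (by omega)]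
  push_cast
  rw [one_div]
  congr 1
  ring

/-! ### The lower bound for the operator Lipschitz norm -/

section LowerBound

theorem IsOperatorLipschitzWith.norm_sub_le {f : ℝ → ℂ} {F : Set ℝ} {C : ℝ≥0}
    (h : IsOperatorLipschitzWith.{u} f F C) (hf : Measurable f) {x y : ℝ} (hx : x ∈ F)
    (hy : y ∈ F) : ‖f x - f y‖ ≤ C * ‖(x : ℂ) - y‖ := by
  -- Multiplication by scalars on a one-dimensional space; `PUnit.{u + 1}` puts this space in the
  -- universe `u`.
  let b := EuclideanSpace.basisFun PUnit.{u + 1} ℂ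
  have key := h.norm_diagOp_sub_le hf b b (l := fun _ => x) (l' := fun _ => y) (fun _ => hx)
    (fun _ => hy)
  have e : ∀ c c' : ℂ, ‖diagOp b (fun _ => c) - diagOp b (fun _ => c')‖ = ‖c - c'‖ := by
    intro c c'
    have : diagOp b (fun _ => c) - diagOp b (fun _ => c') =
        (c - c') • (1 : EuclideanSpace ℂ PUnit.{u + 1} →L[ℂ] EuclideanSpace ℂ PUnit.{u + 1}) := by
      ext1 v
      rw [sub_apply, diagOp_const, diagOp_const, smul_apply, one_apply_eq_self, sub_smul]
    rw [this, norm_smul, norm_one, mul_one]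
  rwa [e, e] at key

theorem one_le_of_isOperatorLipschitzWith_abs {J₁ J₂ : Set ℝ} (hp₁ : J₁ ⊆ Ioi 0)
    (hp₂ : J₂ ⊆ Ioi 0) (hne : J₁.Nontrivial ∨ J₂.Nontrivial) {C : ℝ≥0}
    (h : IsOperatorLipschitzWith.{u} (fun x => ((|x| : ℝ) : ℂ)) (-J₁ ∪ J₂) C) : 1 ≤ C := by
  have hm : Measurable fun x : ℝ => ((|x| : ℝ) : ℂ) :=
    Complex.measurable_ofReal.comp measurable_abs
  obtain ⟨x, y, hx, hy, hxy, hab⟩ : ∃ x y : ℝ, x ∈ -J₁ ∪ J₂ ∧ y ∈ -J₁ ∪ J₂ ∧ x ≠ y ∧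
      |(|x| - |y|)| = |x - y| := by
    rcases hne with ⟨x, hx, y, hy, hxy⟩ | ⟨x, hx, y, hy, hxy⟩
    · refine ⟨-x, -y, Or.inl (by simpa using hx), Or.inl (by simpa using hy), by simpa using hxy, ?_⟩
      rw [abs_neg, abs_neg, abs_of_pos (a := x) (hp₁ hx), abs_of_pos (a := y) (hp₁ hy), neg_sub_neg, abs_sub_comm]
    · exact ⟨x, y, Or.inr hx, Or.inr hy, hxy, by
        rw [abs_of_pos (a := x) (hp₂ hx), abs_of_pos (a := y) (hp₂ hy)]⟩
  have k := h.norm_sub_le hm hx hy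
  rw [← Complex.ofReal_sub, ← Complex.ofReal_sub, Complex.norm_real, Complex.norm_real,
    Real.norm_eq_abs, Real.norm_eq_abs, hab] at k
  have hpos : 0 < |x - y| := abs_pos.2 (sub_ne_zero.2 hxy)
  have : (1 : ℝ) ≤ C := by
    refine le_of_mul_le_mul_right ?_ hpos
    rwa [one_mul]
  exact_mod_cast this

variable {H : Type u} [NormedAddCommGroup H] [InnerProductSpace ℂ H]

theorem rankOne_mul_diagOp {ι : Type*} [Fintype ι] (b : OrthonormalBasis ι ℂ H) (c : ι → ℂ)
    (x : H) (k : ι) : InnerProductSpace.rankOne ℂ x (b k) * diagOp b c =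
      c k • InnerProductSpace.rankOne ℂ x (b k) := by
  ext v
  rw [mul_apply_eq_comp, InnerProductSpace.rankOne_apply, smul_apply,
    InnerProductSpace.rankOne_apply, ← b.repr_apply_apply, repr_diagOp, b.repr_apply_apply, mul_smul]

theorem diagOp_mul_rankOne {ι : Type*} [Fintype ι] (b : OrthonormalBasis ι ℂ H) (c : ι → ℂ)
    (y : H) (j : ι) : diagOp b c * InnerProductSpace.rankOne ℂ (b j) y =
      c j • InnerProductSpace.rankOne ℂ (b j) y := by
  have hb : diagOp b c (b j) = c j • b j := by
    classical
    refine diagOp_ext (b := b) fun i => ?_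
    rw [repr_diagOp, map_smul, PiLp.smul_apply, smul_eq_mul, b.repr_self]
    by_cases h : i = j
    · rw [h]
    · simp [h]
  ext v
  rw [mul_apply_eq_comp, InnerProductSpace.rankOne_apply, smul_apply,
    InnerProductSpace.rankOne_apply, map_smul, hb, smul_comm]

/-- The summand is a product of two antisymmetric factors of the same sign, hence symmetric and
nonnegative. For `k < j`, `2 t k ≤ t j` makes the second factor at least `1 / 3`; the terms with `k
< j` alone already give harmonic sums. -/
theorem harmonic_le_sum_antisymm {n : ℕ} {t : ℕ → ℝ} (ht : ∀ k, 0 < t k)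
    (h2 : ∀ k j, k < j → 2 * t k ≤ t j) :
    (1 / 3) * (n * Real.log (n + 1) - n) ≤
      ∑ j : Fin n, ∑ k : Fin n,
        (1 / (((j : ℕ) : ℝ) - (k : ℕ))) * ((t j - t k) / (t j + t k)) := by
  set w : ℕ → ℕ → ℝ := fun j k => (1 / ((j : ℝ) - k)) * ((t j - t k) / (t j + t k)) with hw
  have hlow : ∀ j k : ℕ, k < j → (1 / 3) * (1 / ((j : ℝ) - k)) ≤ w j k := by
    intro j k hkj
    have hjk : (0 : ℝ) < (j : ℝ) - k := sub_pos.2 (by exact_mod_cast hkj)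
    rw [hw, mul_comm]
    refine mul_le_mul_of_nonneg_left ?_ (one_div_pos.2 hjk).le
    rw [le_div_iff₀ (add_pos (ht j) (ht k))]
    linarith [h2 k j hkj]
  have hsymm : ∀ j k, w j k = w k j := by
    intro j k
    simp only [hw]
    rw [← neg_sub (k : ℝ) j, ← neg_sub (t k) (t j), add_comm (t j), neg_div, one_div_neg_eq_neg_one_div]
    ring
  have hnn : ∀ j k, 0 ≤ w j k := by
    have : ∀ j k : ℕ, k < j → 0 ≤ w j k := fun j k hkj => by
      refine le_trans ?_ (hlow j k hkj)
      have hjk : (0 : ℝ) < (j : ℝ) - k := sub_pos.2 (by exact_mod_cast hkj)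
      positivity
    intro j k
    rcases lt_trichotomy k j with h | h | h
    · exact this j k h
    · simp [hw, h]
    · rw [hsymm]; exact this k j h
  have hsum : ∑ j ∈ Finset.range n, ∑ k ∈ Finset.range n, w j k =
      ∑ j : Fin n, ∑ k : Fin n, w j k := by
    rw [Finset.sum_range]
    exact Finset.sum_congr rfl fun j _ => Finset.sum_range _
  have hlog : Real.log (n + 1) ≤ harmonic n := by exact_mod_cast log_add_one_le_harmonic n
  change _ ≤ ∑ j : Fin n, ∑ k : Fin n, w j k
  rw [← hsum]
  calc (1 / 3) * (n * Real.log (n + 1) - n) ≤ (1 / 3) * (n * (harmonic n : ℝ) - n) := by gcongr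
    _ = (1 / 3) * ((∑ j ∈ Finset.range n, harmonic j : ℚ) : ℝ) := by
        rw [sum_range_harmonic]; push_cast; ring
    _ = ∑ j ∈ Finset.range n, ∑ k ∈ Finset.range j, (1 / 3) * (1 / ((j : ℝ) - k)) := by
        rw [Rat.cast_sum, Finset.mul_sum]
        refine Finset.sum_congr rfl fun j _ => ?_
        rw [← Finset.mul_sum, sum_range_inv_sub_eq_harmonic]
    _ ≤ ∑ j ∈ Finset.range n, ∑ k ∈ Finset.range j, w j k :=
        Finset.sum_le_sum fun j _ => Finset.sum_le_sum fun k hk =>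
          hlow j k (Finset.mem_range.1 hk)
    _ ≤ _ := Finset.sum_le_sum fun j hj =>
        Finset.sum_le_sum_of_subset_of_nonneg
          (Finset.range_subset_range.2 (Finset.mem_range.1 hj).le) fun k _ _ => hnn j k

/-- A logarithmic lower bound for operator Lipschitz constants of `|x|` on sets containing
`±t k`, `k < n`, for a lacunary sequence `t`. -/
theorem log_le_of_isOperatorLipschitzWith_abs {F : Set ℝ} {C : ℝ≥0}
    (h : IsOperatorLipschitzWith.{u} (fun x => ((|x| : ℝ) : ℂ)) F C) {n : ℕ} (hn : n ≠ 0)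
    {t : ℕ → ℝ} (ht : ∀ k, 0 < t k) (h2 : ∀ k j, k < j → 2 * t k ≤ t j)
    (hF : ∀ k < n, t k ∈ F ∧ -t k ∈ F) : Real.log (n + 1) ≤ 1 + 6 * Real.pi * C := by
  have hm : Measurable fun x : ℝ => ((|x| : ℝ) : ℂ) :=
    Complex.measurable_ofReal.comp measurable_abs
  let b : OrthonormalBasis (Fin n ⊕ Fin n) ℂ (EuclideanSpace ℂ (ULift.{u} (Fin n ⊕ Fin n))) :=
    (EuclideanSpace.basisFun (ULift.{u} (Fin n ⊕ Fin n)) ℂ).reindex Equiv.ulift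
  let l : Fin n ⊕ Fin n → ℝ := Sum.elim (fun j => t j) (fun j => -t j)
  have hl : ∀ i, l i ∈ F := by
    rintro (j | j)
    exacts [(hF j j.2).1, (hF j j.2).2]
  let R := fun i j => InnerProductSpace.rankOne ℂ (b i) (b j)
  -- The factor `1 / (t j + t k)` is the inverse of the eigenvalue gap between `t j` and `-t k`, so
  -- the commutator with `D` has entries `±1 / (j - k)`. `Z` is real and antisymmetric, which makes
  -- `K` skew-adjoint; its diagonal is zero because `1 / 0 = 0`.
  let Z : Fin n → Fin n → ℂ := fun j k =>
    (1 / (((j : ℕ) : ℂ) - ((k : ℕ) : ℂ))) * (1 / ((t j : ℂ) + t k))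
  have hts : ∀ j k : ℕ, (t j : ℂ) + t k ≠ 0 := fun j k => by
    exact_mod_cast (add_pos (ht j) (ht k)).ne'
  have hZ : ∀ j k, star (Z j k) = -Z k j := by
    intro j k
    simp only [Z, RCLike.star_def, map_mul, map_div₀, map_one, map_sub, map_add, Complex.conj_ofReal,
      Complex.conj_natCast]
    rw [← neg_sub ((k : ℕ) : ℂ), add_comm (t j : ℂ), one_div_neg_eq_neg_one_div]
    ring
  set K := ∑ j : Fin n, ∑ k : Fin n, Z j k • (R (.inl j) (.inr k) + R (.inr j) (.inl k)) with hKdef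
  have hK : star K = -K := by
    have e : star K = ∑ j : Fin n, ∑ k : Fin n,
        -(Z k j • (R (.inl k) (.inr j) + R (.inr k) (.inl j))) := by
      rw [hKdef, star_sum]
      refine Finset.sum_congr rfl fun j _ => ?_
      rw [star_sum]
      refine Finset.sum_congr rfl fun k _ => ?_
      rw [star_smul, hZ, star_add, ContinuousLinearMap.star_eq_adjoint,
        ContinuousLinearMap.star_eq_adjoint, InnerProductSpace.adjoint_rankOne,
        InnerProductSpace.adjoint_rankOne, neg_smul, add_comm]
    rw [e, Finset.sum_comm, hKdef]
    simp only [Finset.sum_neg_distrib]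
  have hcomm : ∀ c : Fin n ⊕ Fin n → ℂ, K * diagOp b c - diagOp b c * K =
      ∑ j : Fin n, ∑ k : Fin n, (((c (.inr k) - c (.inl j)) * Z j k) • R (.inl j) (.inr k) +
        ((c (.inl k) - c (.inr j)) * Z j k) • R (.inr j) (.inl k)) := by
    intro c
    rw [hKdef, Finset.sum_mul, Finset.mul_sum, ← Finset.sum_sub_distrib]
    refine Finset.sum_congr rfl fun j _ => ?_
    rw [Finset.sum_mul, Finset.mul_sum, ← Finset.sum_sub_distrib]
    refine Finset.sum_congr rfl fun k _ => ?_
    simp only [R]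
    rw [smul_mul_assoc, mul_smul_comm, add_mul, mul_add, rankOne_mul_diagOp, rankOne_mul_diagOp,
      diagOp_mul_rankOne, diagOp_mul_rankOne]
    module
  have key := h.norm_commutator_le hm b hl hK
  have ho₁ : Orthonormal ℂ fun j : Fin n => b (.inl j) :=
    b.orthonormal.comp _ Sum.inl_injective
  have ho₂ : Orthonormal ℂ fun j : Fin n => b (.inr j) :=
    b.orthonormal.comp _ Sum.inr_injective
  have upper : ‖K * diagOp b (fun i => (l i : ℂ)) - diagOp b (fun i => (l i : ℂ)) * K‖ ≤
      2 * Real.pi := by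
    have e : K * diagOp b (fun i => (l i : ℂ)) - diagOp b (fun i => (l i : ℂ)) * K =
        (∑ j : Fin n, ∑ k : Fin n, (1 / (((j : ℕ) : ℂ) - ((k : ℕ) : ℂ))) • R (.inr j) (.inl k)) -
        (∑ j : Fin n, ∑ k : Fin n, (1 / (((j : ℕ) : ℂ) - ((k : ℕ) : ℂ))) • R (.inl j) (.inr k)) := by
      rw [hcomm, ← Finset.sum_sub_distrib]
      refine Finset.sum_congr rfl fun j _ => ?_
      rw [← Finset.sum_sub_distrib]
      refine Finset.sum_congr rfl fun k _ => ?_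
      have e1 : ((l (.inr k) : ℂ) - l (.inl j)) * Z j k = -(1 / (((j : ℕ) : ℂ) - ((k : ℕ) : ℂ))) := by
        simp only [l, Z, Sum.elim_inl, Sum.elim_inr]
        push_cast
        have := hts j k
        rw [show -(t k : ℂ) - t j = -(t j + t k) by ring, neg_mul, mul_left_comm,
          mul_one_div_cancel this, mul_one]
      have e2 : ((l (.inl k) : ℂ) - l (.inr j)) * Z j k = 1 / (((j : ℕ) : ℂ) - ((k : ℕ) : ℂ)) := by
        simp only [l, Z, Sum.elim_inl, Sum.elim_inr]
        push_cast
        have := hts j k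
        rw [show (t k : ℂ) - -(t j : ℂ) = t j + t k by ring, mul_left_comm,
          mul_one_div_cancel this, mul_one]
      rw [e1, e2]
      module
    rw [e]
    refine (norm_sub_le _ _).trans ((add_le_add (norm_hilbertMatrix_le ho₂ ho₁)
      (norm_hilbertMatrix_le ho₁ ho₂)).trans (by linarith))
  set M := K * diagOp b (fun i => ((|l i| : ℝ) : ℂ)) - diagOp b (fun i => ((|l i| : ℝ) : ℂ)) * K
    with hM
  -- Test `M` on the sums `x`, `v` of the eigenvectors for the positive and for the negative
  -- eigenvalues. Both have norm `√n`, and `⟪x, M v⟫` is minus the sum of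
  -- `harmonic_le_sum_antisymm`.
  have lower : (1 / 3) * (n * Real.log (n + 1) - n) ≤ n * ‖M‖ := by
    set x := ∑ j : Fin n, b (.inl j) with hx
    set v := ∑ k : Fin n, b (.inr k) with hv
    have norm_sum : ∀ {e : Fin n → EuclideanSpace ℂ (ULift.{u} (Fin n ⊕ Fin n))},
        Orthonormal ℂ e → ‖∑ j, e j‖ ^ 2 = n := by
      intro e he
      have := he.inner_sum (fun _ => 1) (fun _ => 1) Finset.univ
      simp only [one_smul, map_one, mul_one, Finset.sum_const, Finset.card_univ, Fintype.card_fin,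
        nsmul_eq_mul] at this
      have h' := congrArg Complex.re this
      rw [Complex.natCast_re] at h'
      rw [← h']
      exact (inner_self_eq_norm_sq (𝕜 := ℂ) _).symm
    have hxn : ‖x‖ ^ 2 = n := norm_sum ho₁
    have hvn : ‖v‖ ^ 2 = n := norm_sum ho₂
    have hxv : ‖x‖ * ‖v‖ = n := by
      have : ‖x‖ = ‖v‖ := by
        rw [← Real.sqrt_sq (norm_nonneg x), ← Real.sqrt_sq (norm_nonneg v), hxn, hvn]
      rw [this, ← sq, hvn]
    have hin : inner ℂ x (M v) = -((∑ j : Fin n, ∑ k : Fin n,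
        (1 / (((j : ℕ) : ℝ) - (k : ℕ))) * ((t j - t k) / (t j + t k)) : ℝ) : ℂ) := by
      have hMv : M v = ∑ j : Fin n, ∑ k : Fin n, (((t k : ℂ) - t j) * Z j k) • b (.inl j) := by
        rw [hM, hcomm, sum_apply]
        refine Finset.sum_congr rfl fun j _ => ?_
        rw [sum_apply]
        refine Finset.sum_congr rfl fun k _ => ?_
        have i1 : inner ℂ (b (.inr k)) v = 1 := by
          have := ho₂.inner_right_fintype (fun _ => 1) k
          simpa using this
        have i2 : inner ℂ (b (.inl k)) v = 0 := by
          rw [hv, inner_sum]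
          refine Finset.sum_eq_zero fun i _ => ?_
          exact b.orthonormal.2 (by simp)
        simp only [R, add_apply, smul_apply, InnerProductSpace.rankOne_apply, i1, i2, l,
          Sum.elim_inl, Sum.elim_inr, abs_neg, abs_of_pos (ht _), one_smul, zero_smul, smul_zero,
          add_zero]
      have i3 : ∀ j : Fin n, inner ℂ x (b (.inl j)) = 1 := by
        intro j
        have := ho₁.inner_left_fintype (fun _ => 1) j
        simpa using this
      rw [hMv, inner_sum]
      push_cast
      rw [← Finset.sum_neg_distrib]
      refine Finset.sum_congr rfl fun j _ => ?_
      rw [inner_sum, ← Finset.sum_neg_distrib]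
      refine Finset.sum_congr rfl fun k _ => ?_
      rw [inner_smul_right, i3]
      simp only [Z]
      ring
    have hb := (norm_inner_le_norm (𝕜 := ℂ) x (M v)).trans
      (mul_le_mul_of_nonneg_left (M.le_opNorm v) (norm_nonneg x))
    rw [hin, norm_neg, Complex.norm_real, Real.norm_eq_abs] at hb
    refine (harmonic_le_sum_antisymm ht h2).trans ((le_abs_self _).trans (hb.trans ?_))
    rw [← hxv]
    linarith
  have hnpos : (0 : ℝ) < n := by exact_mod_cast Nat.pos_of_ne_zero hn
  have hMle : ‖M‖ ≤ C * (2 * Real.pi) := key.trans (by gcongr)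
  have : (1 / 3) * (Real.log (n + 1) - 1) ≤ ‖M‖ := by
    refine le_of_mul_le_mul_left ?_ hnpos
    linarith
  linarith

/-- The points `x exp k`, `k ≤ ⌊L⌋`, lie between `x` and `y` and form a lacunary sequence since `e ≥
2`. The exponent `21 C` absorbs `log 2 + 1 + 6πC`, using `C ≥ 1`. -/
theorem two_add_sub_log_le_exp {J₁ J₂ : Set ℝ} (hJ₁ : J₁.OrdConnected) (hJ₂ : J₂.OrdConnected)
    (hp₁ : J₁ ⊆ Ioi 0) {C : ℝ≥0} (hC : 1 ≤ C)
    (h : IsOperatorLipschitzWith.{u} (fun x => ((|x| : ℝ) : ℂ)) (-J₁ ∪ J₂) C) {x y : ℝ}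
    (hx : x ∈ J₁ ∩ J₂) (hy : y ∈ J₁ ∩ J₂) (hxy : x ≤ y) :
    2 + (Real.log y - Real.log x) ≤ Real.exp (21 * C) := by
  have hx0 : 0 < x := hp₁ hx.1
  have hy0 : 0 < y := hp₁ hy.1
  set L := Real.log y - Real.log x with hL
  have hL0 : 0 ≤ L := sub_nonneg.2 (Real.log_le_log hx0 hxy)
  have hmem : ∀ k < ⌊L⌋₊ + 1, x * Real.exp k ∈ J₁ ∩ J₂ := by
    intro k hk
    refine (hJ₁.inter hJ₂).out hx hy ⟨?_, ?_⟩
    · exact le_mul_of_one_le_right hx0.le (Real.one_le_exp (Nat.cast_nonneg k))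
    · have : (k : ℝ) ≤ L := (Nat.cast_le.2 (Nat.lt_succ_iff.1 hk)).trans (Nat.floor_le hL0)
      calc x * Real.exp k ≤ x * Real.exp L := by gcongr
        _ = y := by
          rw [hL, Real.exp_sub, Real.exp_log hx0, Real.exp_log hy0]
          field_simp
  have key := log_le_of_isOperatorLipschitzWith_abs h (Nat.succ_ne_zero ⌊L⌋₊)
    (t := fun k => x * Real.exp k) (fun k => by positivity) (fun k j hkj => by
      have h1 : (k : ℝ) + 1 ≤ j := by exact_mod_cast hkj
      have h2 : Real.exp 1 * Real.exp k ≤ Real.exp j := by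
        rw [← Real.exp_add, Real.exp_le_exp]
        linarith
      have h3 : (2 : ℝ) ≤ Real.exp 1 := by linarith [Real.add_one_le_exp (1 : ℝ)]
      calc 2 * (x * Real.exp k) = x * (2 * Real.exp k) := by ring
        _ ≤ x * (Real.exp 1 * Real.exp k) := by gcongr
        _ ≤ _ := by gcongr)
    (fun k hk => ⟨Or.inr (hmem k hk).2, Or.inl (by simpa using (hmem k hk).1)⟩)
  have hC' : (1 : ℝ) ≤ C := by exact_mod_cast hC
  have h1 : 1 + L ≤ ((⌊L⌋₊.succ : ℕ) : ℝ) + 1 := by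
    push_cast
    linarith [(Nat.lt_floor_add_one L).le]
  have h2 : Real.log (1 + L) ≤ 1 + 6 * Real.pi * C :=
    (Real.log_le_log (by linarith) h1).trans key
  have h3 : Real.log (2 + L) ≤ Real.log 2 + Real.log (1 + L) := by
    rw [← Real.log_mul (by norm_num) (by linarith)]
    exact Real.log_le_log (by linarith) (by linarith)
  have h4 : Real.log (2 + L) ≤ 21 * C := by
    have := Real.log_two_lt_d9
    have hpi := Real.pi_lt_d2
    nlinarith
  exact (Real.log_le_iff_le_exp (by linarith)).1 h4

end LowerBound

/-! ### Extended logarithm and the final constants -/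

theorem logTwoAdd_ofReal {r : ℝ} (hr : 0 ≤ r) :
    logTwoAdd (ENNReal.ofReal r) = ENNReal.ofReal (Real.log (2 + r)) := by
  have h2 : (2 : ℝ≥0∞) + ENNReal.ofReal r = ENNReal.ofReal (2 + r) := by
    rw [ENNReal.ofReal_add (by norm_num) hr, ENNReal.ofReal_ofNat]
  rw [logTwoAdd, h2, ENNReal.log_ofReal_of_pos (by linarith), EReal.toENNReal_of_ne_top (by simp),
    EReal.toReal_coe]

theorem logTwoAdd_mono {l l' : ℝ≥0∞} (h : l ≤ l') : logTwoAdd l ≤ logTwoAdd l' :=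
  EReal.toENNReal_le_toENNReal (ENNReal.log_monotone (by gcongr))

theorem logTwoAdd_top : logTwoAdd ⊤ = ⊤ := by simp [logTwoAdd]

theorem exists_nat_le_two_pow {r : ℝ} (hr : 0 ≤ r) :
    ∃ n : ℕ, r ≤ 2 ^ n ∧ 10 + 3 * (n : ℝ) ≤ 30 * Real.log (2 + r) := by
  have h2 : 0 < Real.log 2 := Real.log_pos (by norm_num)
  have hl : Real.log 2 ≤ Real.log (2 + r) := Real.log_le_log (by norm_num) (by linarith)
  -- Since `1 / log 2 ≤ 2`, this `n` is at most `2 log (2 + r) + 1`, so `10 + 3n ≤ 13 + 6 log (2 +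
  -- r)`; the `13` is absorbed because `log (2 + r) ≥ log 2`.
  refine ⟨⌈Real.log (2 + r) / Real.log 2⌉₊, ?_, ?_⟩
  · have h := Nat.le_ceil (Real.log (2 + r) / Real.log 2)
    rw [div_le_iff₀ h2, ← Real.log_pow, Real.log_le_log_iff (by linarith) (by positivity)] at h
    linarith
  · have h := (Nat.ceil_lt_add_one (a := Real.log (2 + r) / Real.log 2)
      (div_nonneg (h2.le.trans hl) h2.le)).le
    have h3 := Real.log_two_gt_d9
    have h4 : Real.log (2 + r) / Real.log 2 ≤ 2 * Real.log (2 + r) := by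
      rw [div_le_iff₀ h2]
      nlinarith
    linarith

theorem mainTheorem4 :
    ∃ C₁ C₂ : ℝ≥0, 0 < C₁ ∧ 0 < C₂ ∧
      ∀ J₁ J₂ : Set ℝ, J₁.OrdConnected → J₂.OrdConnected → J₁ ⊆ Ioi 0 → J₂ ⊆ Ioi 0 →
        (J₁.Nontrivial ∨ J₂.Nontrivial) →
        C₁ * logTwoAdd (logLength (J₁ ∩ J₂))
            ≤ operatorLipschitzNorm.{u} (fun x => ((|x| : ℝ) : ℂ)) (-J₁ ∪ J₂) ∧
        operatorLipschitzNorm.{u} (fun x => ((|x| : ℝ) : ℂ)) (-J₁ ∪ J₂)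
            ≤ C₂ * logTwoAdd (logLength (J₁ ∩ J₂)) := by
  refine ⟨1 / 21, 30, by norm_num, by norm_num, fun J₁ J₂ hJ₁ hJ₂ hp₁ hp₂ hne => ⟨?_, ?_⟩⟩
  · refine le_iInf₂ fun C h => ?_
    have hC := one_le_of_isOperatorLipschitzWith_abs hp₁ hp₂ hne h
    have hC' : (1 : ℝ) ≤ C := by exact_mod_cast hC
    have hexp : 2 ≤ Real.exp (21 * C) := by linarith [Real.add_one_le_exp (21 * (C : ℝ))]
    -- Any admissible finite `C` forces a finite logarithmic length. If the length is infinite there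
    -- is thus no such `C`, and the norm is `∞` as claimed.
    have hlen : logLength (J₁ ∩ J₂) ≤ ENNReal.ofReal (Real.exp (21 * C) - 2) := by
      refine (Real.volume_le_diam _).trans (Metric.ediam_le ?_)
      rintro _ ⟨x, hx, rfl⟩ _ ⟨y, hy, rfl⟩
      rw [edist_dist, Real.dist_eq]
      refine ENNReal.ofReal_le_ofReal ?_
      rcases le_total x y with hxy | hxy
      · rw [abs_sub_comm, abs_of_nonneg (sub_nonneg.2 (Real.log_le_log (hp₁ hx.1) hxy))]
        linarith [two_add_sub_log_le_exp hJ₁ hJ₂ hp₁ hC h hx hy hxy]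
      · rw [abs_of_nonneg (sub_nonneg.2 (Real.log_le_log (hp₁ hy.1) hxy))]
        linarith [two_add_sub_log_le_exp hJ₁ hJ₂ hp₁ hC h hy hx hxy]
    have hlog := logTwoAdd_mono hlen
    rw [logTwoAdd_ofReal (by linarith), add_sub_cancel, Real.log_exp] at hlog
    calc ((1 / 21 : ℝ≥0) : ℝ≥0∞) * logTwoAdd (logLength (J₁ ∩ J₂))
        ≤ ((1 / 21 : ℝ≥0) : ℝ≥0∞) * ENNReal.ofReal (21 * C) := by gcongr
      _ = C := by
        have : ENNReal.ofReal (21 * C) = ((21 * C : ℝ≥0) : ℝ≥0∞) := by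
          rw [← ENNReal.ofReal_coe_nnreal]
          simp
        rw [this, ← ENNReal.coe_mul, ← mul_assoc]
        norm_num
  · rcases eq_or_ne (logLength (J₁ ∩ J₂)) ⊤ with htop | htop
    · rw [htop, logTwoAdd_top, ENNReal.mul_top (by norm_num)]
      exact le_top
    · obtain ⟨n, hn, hn'⟩ := exists_nat_le_two_pow
        (ENNReal.toReal_nonneg (a := logLength (J₁ ∩ J₂)))
      have hlen : logLength (J₁ ∩ J₂) = ENNReal.ofReal (logLength (J₁ ∩ J₂)).toReal :=
        (ENNReal.ofReal_toReal htop).symm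
      have hv : logLength (J₁ ∩ J₂) ≤ ENNReal.ofReal (2 ^ n) := by
        rw [hlen]
        exact ENNReal.ofReal_le_ofReal hn
      refine (iInf₂_le _ (isOperatorLipschitzWith_abs hJ₁ hJ₂ hp₁ hp₂ hv)).trans ?_
      rw [hlen, logTwoAdd_ofReal ENNReal.toReal_nonneg, ← ENNReal.ofReal_coe_nnreal,
        ← ENNReal.ofReal_coe_nnreal, ← ENNReal.ofReal_mul (by positivity)]
      refine ENNReal.ofReal_le_ofReal ?_
      push_cast
      exact hn'
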